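/- Let $m$ denote Lebesgue measure on $\mathbb{R}^n$ ($n\ge 1$) and $|\cdot|$ the Euclidean norm. A multiresolution analysis (MRA) of $L^2(\mathbb{R}^n)$ is an increasing sequence $\{V_j\}_{j\in\mathbb{Z}}$ of closed linear subspaces of $L^2(\mathbb{R}^n)$ such that (i) $f\in V_j\Leftrightarrow f(2\,\cdot)\in V_{j+1}$; (ii) $f\in V_0\Leftrightarrow f(\cdot-\mathbf m)\in V_0$ for $\mathbf m\in\mathbb{Z}^n$; (iii) $\bigcap_j V_j=\{0\}$ and $\bigcup_j V_j$ is dense in $L^2(\mathbb{R}^n)$; (iv) there is $\phi\in L^2(\mathbb{R}^n)$, called a scaling function, such that $\{\phi(\cdot-\mathbf m)\}_{\mathbf m\in\mathbb{Z}^n}$ is an orthonormal basis of $V_0$. A complex Radon measure $\mu$ on $\mathbb{R}^n$ is a complex-valued set function on the bounded Borel sets that is countably additive on disjoint sequences with bounded union; $|\mu|$ is its total variation measure, and $\mu$ is tempered if $\int_{\mathbb{R}^n}(1+|\mathbf x|)^{-k}\,d|\mu|(\mathbf x)<\infty$ for some $k\ge 0$. Borel sets $B_\nu$ ($\nu\in\mathbb{N}$)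 shrink regularly to $\mathbf x_0$ if there are radii $\varepsilon_\nu>0$ with $\varepsilon_\nu\to0$ and a constant $a>0$ such that $B_\nu\subseteq B(\mathbf x_0,\varepsilon_\nu)$ and $m(B_\nu)\ge a\,\varepsilon_\nu^n$ for all $\nu$, where $B(\mathbf x_0,\varepsilon)$ is the open ball. The point $\mathbf x_0$ is a Lebesgue density point of $\mu$ with value $\gamma_{\mathbf x_0}\in\mathbb{C}$ if $\mu(B_\nu)/m(B_\nu)\to\gamma_{\mathbf x_0}$ for every sequence of Borel sets shrinking regularly to $\mathbf x_0$. **Theorem 1.2.** Suppose that the MRA $\{V_j\}_{j\in\mathbb{Z}}$ has a continuous scaling function $\phi$ such that $\lim_{|\mathbf x|\to\infty}|\mathbf x|^l\phi(\mathbf x)=0$ for all $l\in\mathbb{N}$, and let $\mu$ be a tempered complex Radon measure on $\mathbb{R}^n$. Put $$q_0(\mathbf x,\mathbf y)=\sum_{\mathbf m\in\mathbb{Z}^n}\phi(\mathbf x-\mathbf m)\overline{\phi(\mathbf y-\mathbf m)},\qquad q_j(\mathbf x,\mathbf y)=2^{nj}q_0(2^j\mathbf x,2^j\mathbf y),\qquad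 (q_j\mu)(\mathbf x)=\int_{\mathbb{R}^n}q_j(\mathbf x,\mathbf y)\,d\mu(\mathbf y)$$ for $j\in\mathbb{Z}$. The series converges absolutely for all $\mathbf x,\mathbf y$, and $q_j(\mathbf x,\cdot)$ is $|\mu|$-integrable for all $j$ and $\mathbf x$, so that $q_j\mu$ is well defined. Then $$\lim_{j\to\infty}(q_j\mu)(\mathbf x_0)=\gamma_{\mathbf x_0}$$ at every Lebesgue density point $\mathbf x_0$ of $\mu$, where $\gamma_{\mathbf x_0}$ is the value of $\mu$ at $\mathbf x_0$. In particular, $\mu$ has a Lebesgue decomposition $d\mu=f\,dm+d\mu_s$, with $f\in L^1_{loc}(\mathbb{R}^n)$ and $\mu_s$ a complex Radon measure that is singular with respect to $m$; and for every such decomposition, $m$-almost every $\mathbf x_0$ is a Lebesgue density point of $\mu$ with value $\gamma_{\mathbf x_0}=f(\mathbf x_0)$, so that $\lim_{j\to\infty}(q_j\mu)(\mathbf x_0)=f(\mathbf x_0)$ for $m$-almost every $\mathbf x_0$. -/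

import Mathlib

open MeasureTheory Filter Topology Set
open scoped ENNReal ComplexConjugate

noncomputable section

namespace MRAPaper

/-- `ℝⁿ` with its Euclidean norm. -/
abbrev Rn (n : ℕ) : Type := EuclideanSpace ℝ (Fin n)

/-- `L²(ℝⁿ)`, complex valued, with respect to Lebesgue measure. -/
abbrev L2 (n : ℕ) : Type := Lp ℂ 2 (volume : Measure (Rn n))

/-- The point of the lattice `ℤⁿ ⊆ ℝⁿ` with the given integer coordinates. -/
def latticePoint {n : ℕ} (m : Fin n → ℤ) : Rn n := WithLp.toLp 2 fun i => (m i : ℝ)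

/-! ### Multiresolution analyses -/

/-- `φ` is a scaling function of `V`: the integer translates `φ(· - m)` are an orthonormal
(Hilbert) basis of `V₀`. In particular the class of `φ` itself lies in `V₀ ⊆ L²(ℝⁿ)`. -/
def IsScalingFunction {n : ℕ} (V : ℤ → Submodule ℂ (L2 n)) (φ : Rn n → ℂ) : Prop :=
  ∃ b : HilbertBasis (Fin n → ℤ) ℂ (V 0), ∀ m : Fin n → ℤ,
    ((b m : L2 n) : Rn n → ℂ) =ᵐ[volume] fun x => φ (x - latticePoint m)

/-- A multiresolution analysis of `L²(ℝⁿ)`. -/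
structure IsMRA {n : ℕ} (V : ℤ → Submodule ℂ (L2 n)) : Prop where
  isClosed : ∀ j, IsClosed (V j : Set (L2 n))
  monotone : Monotone V
  /-- `f ∈ V_j ↔ f(2 ·) ∈ V_{j+1}`; here `g` is the class of `f(2 ·)`. -/
  dilation : ∀ (j : ℤ) (f g : L2 n),
    ((g : Rn n → ℂ) =ᵐ[volume] fun x => (f : Rn n → ℂ) ((2 : ℝ) • x)) →
      (f ∈ V j ↔ g ∈ V (j + 1))
  /-- `f ∈ V_0 ↔ f(· - m) ∈ V_0`; here `g` is the class of `f(· - m)`. -/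
  translation : ∀ (m : Fin n → ℤ) (f g : L2 n),
    ((g : Rn n → ℂ) =ᵐ[volume] fun x => (f : Rn n → ℂ) (x - latticePoint m)) →
      (f ∈ V 0 ↔ g ∈ V 0)
  iInf_eq_bot : ⨅ j, V j = ⊥
  dense_iUnion : Dense (⋃ j, (V j : Set (L2 n)))
  exists_scalingFunction : ∃ φ : Rn n → ℂ, IsScalingFunction V φ

/-- The reproducing kernel `q₀(x, y) = ∑_{m ∈ ℤⁿ} φ(x - m) conj φ(y - m)` of `V₀`. -/
def kernelZero {n : ℕ} (φ : Rn n → ℂ) (x y : Rn n) : ℂ :=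
  ∑' m : Fin n → ℤ, φ (x - latticePoint m) * conj (φ (y - latticePoint m))

/-- The reproducing kernel `q_j(x, y) = 2^{nj} q₀(2^j x, 2^j y)` of `V_j`. -/
def kernel {n : ℕ} (φ : Rn n → ℂ) (j : ℤ) (x y : Rn n) : ℂ :=
  (2 : ℂ) ^ ((n : ℤ) * j) * kernelZero φ ((2 : ℝ) ^ j • x) ((2 : ℝ) ^ j • y)

/-! ### Complex Radon measures on `ℝⁿ`, not necessarily of finite total variation -/

/-- A complex Radon measure on `ℝⁿ`: a complex valued set function on the bounded Borel sets
that is countably additive as long as the union stays bounded. (Only the values on bounded Borel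
sets are meaningful.) -/
structure ComplexRadonMeasure (n : ℕ) where
  toFun : Set (Rn n) → ℂ
  hasSum_iUnion : ∀ B : ℕ → Set (Rn n), (∀ i, MeasurableSet (B i)) →
    Bornology.IsBounded (⋃ i, B i) → Pairwise (Function.onFun Disjoint B) →
      HasSum (fun i => toFun (B i)) (toFun (⋃ i, B i))

/-- The half-open spherical shells `{k ≤ |x| < k + 1}`, which partition `ℝⁿ` into bounded Borel
sets. -/
def shell (n k : ℕ) : Set (Rn n) := {x | (k : ℝ) ≤ ‖x‖ ∧ ‖x‖ < (k : ℝ) + 1}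

theorem measurableSet_shell (n k : ℕ) : MeasurableSet (shell n k) :=
  (measurableSet_le measurable_const measurable_norm).inter
    (measurableSet_lt measurable_norm measurable_const)

theorem isBounded_shell (n k : ℕ) : Bornology.IsBounded (shell n k) :=
  Metric.isBounded_ball.subset (fun x hx => by
    simpa using hx.2 : shell n k ⊆ Metric.ball 0 ((k : ℝ) + 1))

namespace ComplexRadonMeasure

variable {n : ℕ}

theorem toFun_empty (μ : ComplexRadonMeasure n) : μ.toFun ∅ = 0 := by
  have h := μ.hasSum_iUnion (fun _ => ∅) (fun _ => MeasurableSet.empty) (by simp)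
    (fun _ _ _ => by simp [Function.onFun])
  exact tendsto_nhds_unique tendsto_const_nhds h.summable.tendsto_atTop_zero

open Classical in
/-- The restriction `A ↦ μ(A ∩ K)` of `μ` to a bounded Borel set `K`, a finite complex measure. -/
def restrict (μ : ComplexRadonMeasure n) (K : Set (Rn n)) (hK : MeasurableSet K)
    (hb : Bornology.IsBounded K) : ComplexMeasure (Rn n) where
  measureOf' A := if MeasurableSet A then μ.toFun (A ∩ K) else 0
  empty' := by simp [toFun_empty]
  not_measurable' A hA := by simp [hA]
  m_iUnion' f hf hd := by
    have h := μ.hasSum_iUnion (fun i => f i ∩ K) (fun i => (hf i).inter hK)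
      (hb.subset (iUnion_subset fun i => inter_subset_right))
      (fun i j hij => (hd hij).mono inter_subset_left inter_subset_left)
    rw [← iUnion_inter] at h
    simpa [hf, MeasurableSet.iUnion hf] using h

/-- The restriction of `μ` to the `k`-th shell. -/
def onShell (μ : ComplexRadonMeasure n) (k : ℕ) : ComplexMeasure (Rn n) :=
  μ.restrict (shell n k) (measurableSet_shell n k) (isBounded_shell n k)

/-- The total variation measure `|μ|`, a positive Borel measure on `ℝⁿ`: the sum of the total
variation measures of the restrictions of `μ` to the shells, which partition `ℝⁿ`. -/
def variation (μ : ComplexRadonMeasure n) : Measure (Rn n) :=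
  Measure.sum fun k => (μ.onShell k).variation

/-- `g` is integrable with respect to `μ`, that is, with respect to `|μ|`. -/
def Integrable (μ : ComplexRadonMeasure n) (g : Rn n → ℂ) : Prop :=
  MeasureTheory.Integrable g μ.variation

/-- The integral `∫ g dμ`, for `g` integrable with respect to `μ`: the (absolutely convergent) sum
of the integrals over the shells. -/
def integral (μ : ComplexRadonMeasure n) (g : Rn n → ℂ) : ℂ :=
  ∑' k, (μ.onShell k).integral g (ContinuousLinearMap.mul ℝ ℂ)

/-- `μ` is tempered: `∫ (1 + |x|)^{-k} d|μ|(x) < ∞` for some `k ≥ 0`. -/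
def IsTempered (μ : ComplexRadonMeasure n) : Prop :=
  ∃ k : ℝ, 0 ≤ k ∧ ∫⁻ x, ENNReal.ofReal (1 / (1 + ‖x‖) ^ k) ∂μ.variation < ∞

/-- `dμ = f dm + dμₛ` is the Lebesgue decomposition of `μ`: `f` is locally integrable and `μₛ` is
singular with respect to Lebesgue measure `m`. -/
structure IsLebesgueDecomposition (μ : ComplexRadonMeasure n) (f : Rn n → ℂ)
    (μs : ComplexRadonMeasure n) : Prop where
  locallyIntegrable : LocallyIntegrable f (volume : Measure (Rn n))
  mutuallySingular : Measure.MutuallySingular μs.variation (volume : Measure (Rn n))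
  eq_add : ∀ B : Set (Rn n), MeasurableSet B → Bornology.IsBounded B →
    μ.toFun B = (∫ x in B, f x) + μs.toFun B

end ComplexRadonMeasure

/-- The Borel sets `B_ν` shrink regularly to `x₀`. -/
def ShrinksRegularly {n : ℕ} (B : ℕ → Set (Rn n)) (x₀ : Rn n) : Prop :=
  (∀ ν, MeasurableSet (B ν)) ∧
  ∃ ε : ℕ → ℝ, (∀ ν, 0 < ε ν) ∧ Tendsto ε atTop (𝓝 0) ∧
    (∀ ν, B ν ⊆ Metric.ball x₀ (ε ν)) ∧
    ∃ a : ℝ, 0 < a ∧ ∀ ν, a * ε ν ^ n ≤ volume.real (B ν)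

/-- `x₀` is a Lebesgue density point of `μ`, with value `γ`: `μ(B_ν) / m(B_ν) → γ` for every
sequence of Borel sets that shrinks regularly to `x₀`. -/
def IsLebesgueDensityPoint {n : ℕ} (μ : ComplexRadonMeasure n) (x₀ : Rn n) (γ : ℂ) : Prop :=
  ∀ B : ℕ → Set (Rn n), ShrinksRegularly B x₀ →
    Tendsto (fun ν => μ.toFun (B ν) / (volume.real (B ν) : ℂ)) atTop (𝓝 γ)

/-- The multiresolution expansion `(q_j μ)(x) = ∫ q_j(x, y) dμ(y)`. -/
def expansion {n : ℕ} (φ : Rn n → ℂ) (μ : ComplexRadonMeasure n) (j : ℤ) (x : Rn n) : ℂ :=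
  μ.integral fun y => kernel φ j x y

end MRAPaper

end

/-! The kernels q_j(x₀, ·) form an approximate identity, and the subtle point is that their total
mass is exactly one.

Granting this (`IsMRA.integral_kernelZero_eq_one`), put σ = μ − γ m, so that (q_j μ)(x₀) − γ = ∫
q_j(x₀, y) dσ(y). Rapid decay of φ gives |q_j(x, y)| ≤ C 2^{nj} (1 + 2^j|x − y|)^{-L} for every L.
Since σ has density value 0 at x₀, also |σ|(B(x₀, r)) = o(r^n)
(`IsLebesgueDensityPoint.tendsto_variation_ball`): |σ|(B) is at most 8|σ(A)| for some A ⊆ B, and A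
or B \ A fills half of B. Cutting the integral into dyadic balls about x₀ then gives the limit
(`tendsto_lintegral_concentrating`): small balls are negligible, and temperedness controls large
ones.

The mass Φ(x) = ∫ q₀(x, y) dy is continuous and ℤⁿ-periodic. If Φ ≠ 1 somewhere, then |1 − Φ| stays
away from 0 on a fixed proportion of every large cube. Since q₀ is the kernel of the projection onto
V₀, indicators of balls of radius comparable to 2^j then have squared distance at least a multiple
of 2^{nj} from V₀. Rescaled, this keeps one fixed indicator away from every V_j with j large,
against density of the union.

The almost everywhere statement is Lebesgue differentiation applied to f and to the singular part.
-/

noncomputable section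

namespace MRAPaper

/-! ### Complex measures: finiteness of the variation, almost extremal sets, integrals. -/

section ComplexMeasure

variable {α : Type*} [MeasurableSpace α]

theorem re_apply (c : ComplexMeasure α) (s : Set α) : ComplexMeasure.re c s = (c s).re := rfl

theorem im_apply (c : ComplexMeasure α) (s : Set α) : ComplexMeasure.im c s = (c s).im := rfl

/-- Reduces questions on the variation to signed measures, where the Jordan decomposition is
available. -/
theorem variation_le_re_add_im (c : ComplexMeasure α) :
    c.variation ≤ (ComplexMeasure.re c).variation + (ComplexMeasure.im c).variation := by
  refine VectorMeasure.variation_le_of_forall_enorm_le fun E _ => ?_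
  calc ‖c E‖ₑ = ‖((c E).re : ℂ) + (c E).im * Complex.I‖ₑ := by rw [Complex.re_add_im]
    _ ≤ ‖((c E).re : ℂ)‖ₑ + ‖((c E).im : ℂ) * Complex.I‖ₑ := enorm_add_le _ _
    _ = ‖(c E).re‖ₑ + ‖(c E).im‖ₑ := by
      simp [← ofReal_norm]
    _ ≤ _ := by
      rw [← re_apply, ← im_apply]
      exact add_le_add (VectorMeasure.enorm_measure_le_variation _ _)
        (VectorMeasure.enorm_measure_le_variation _ _)

instance isFiniteMeasure_variation_complexMeasure (c : ComplexMeasure α) :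
    IsFiniteMeasure c.variation := by
  have h : ∀ s : SignedMeasure α, IsFiniteMeasure s.variation := fun s => by
    rw [← SignedMeasure.totalVariation_eq_variation]; infer_instance
  have := h (ComplexMeasure.re c)
  have := h (ComplexMeasure.im c)
  exact isFiniteMeasure_of_le _ (variation_le_re_add_im c)

/-- The total variation of a complex measure is realized by a single set, up to a factor. -/
theorem exists_subset_variation_le (c : ComplexMeasure α) {s : Set α} (hs : MeasurableSet s) :
    ∃ t ⊆ s, MeasurableSet t ∧ c.variation s ≤ 8 * ‖c t‖ₑ := by
  rcases eq_or_ne (c.variation s) 0 with h0 | h0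
  · exact ⟨∅, empty_subset _, MeasurableSet.empty, by simp [h0]⟩
  set a := c.variation s with ha
  have htop : a ≠ ∞ := measure_ne_top _ _
  have hle : a ≤ (ComplexMeasure.re c).variation s + (ComplexMeasure.im c).variation s :=
    variation_le_re_add_im c s
  have h4 : a / 4 + a / 4 < a := by
    have : a / 4 + a / 4 = a / 2 := by
      rw [← ENNReal.add_div, ← two_mul, ENNReal.div_eq_div_iff (by norm_num) (by norm_num)
        (by norm_num) (by norm_num)]
      ring
    rw [this]
    exact ENNReal.half_lt_self h0 htop
  -- The constant 8 is 4 · 2: the real or the imaginary part carries more than a quarter of the mass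
  -- (strictly, as `a` is finite and nonzero), and a signed measure loses a further factor 2 in
  -- passing to one set.
  have key : a / 4 < (ComplexMeasure.re c).variation s ∨
      a / 4 < (ComplexMeasure.im c).variation s := by
    by_contra! h
    exact absurd (hle.trans (add_le_add h.1 h.2)) (not_le.2 h4)
  have fin : ∀ t : Set α, a / 4 < 2 * ‖c t‖ₑ → a ≤ 8 * ‖c t‖ₑ := fun t ht => by
    have h := (ENNReal.div_lt_iff (Or.inl (by norm_num)) (Or.inl (by norm_num))).1 ht
    calc a ≤ 2 * ‖c t‖ₑ * 4 := h.le
      _ = 8 * ‖c t‖ₑ := by ring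
  rcases key with h | h
  · obtain ⟨t, ts, tm, ht⟩ :=
      SignedMeasure.exists_subset_lt_enorm_apply_of_lt_variation _ hs h
    refine ⟨t, ts, tm, fin t (ht.trans_le ?_)⟩
    gcongr
    rw [re_apply, ← ofReal_norm, ← ofReal_norm]
    exact ENNReal.ofReal_le_ofReal (Complex.abs_re_le_norm _)
  · obtain ⟨t, ts, tm, ht⟩ :=
      SignedMeasure.exists_subset_lt_enorm_apply_of_lt_variation _ hs h
    refine ⟨t, ts, tm, fin t (ht.trans_le ?_)⟩
    gcongr
    rw [im_apply, ← ofReal_norm, ← ofReal_norm]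
    exact ENNReal.ofReal_le_ofReal (Complex.abs_im_le_norm _)

/-- The integral against a constant complex multiple of a finite positive measure. -/
theorem integral_eq_of_eq_mul (c : ComplexMeasure α) (m : Measure α) [IsFiniteMeasure m] (γ : ℂ)
    (hc : ∀ s, MeasurableSet s → c s = m.real s * γ) {g : α → ℂ}
    (hg : MeasureTheory.Integrable g m) :
    c.integral g (ContinuousLinearMap.mul ℝ ℂ) = (∫ x, g x ∂m) * γ := by
  have hle : c.variation ≤ (‖γ‖₊ : ℝ≥0∞) • m := by
    refine VectorMeasure.variation_le_of_forall_enorm_le fun E hE => ?_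
    rw [hc E hE, enorm_mul, Measure.smul_apply, smul_eq_mul, mul_comm]
    refine mul_le_mul' le_rfl (le_of_eq ?_)
    rw [← ofReal_norm, Complex.norm_real, Real.norm_of_nonneg measureReal_nonneg]
    exact ofReal_measureReal
  have hT : DominatedFinMeasAdditive m (c.transpose (ContinuousLinearMap.mul ℝ ℂ)) ‖γ‖ := by
    refine ⟨fun s t hs ht _ _ hd =>
      cbmApplyMeasure_union c (ContinuousLinearMap.mul ℝ ℂ) hs ht hd, fun s hs _ => ?_⟩
    refine (norm_cbmApplyMeasure_le c (ContinuousLinearMap.mul ℝ ℂ) s).trans ?_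
    rw [hc s hs, norm_mul, Complex.norm_real, Real.norm_of_nonneg measureReal_nonneg]
    calc _ ≤ 1 * (m.real s * ‖γ‖) := by
          gcongr
          exact ContinuousLinearMap.opNorm_mul_le ℝ ℂ
      _ = ‖γ‖ * m.real s := by ring
  -- As `c.variation` is dominated by a multiple of `m`, the integral may be built over `m`, where
  -- induction on integrable functions applies.
  have hrepr : ∀ f : α → ℂ, MeasureTheory.Integrable f m →
      c.integral f (ContinuousLinearMap.mul ℝ ℂ) = setToFun m _ hT f := fun f hf =>
    (setToFun_congr_measure_of_integrable _ ENNReal.coe_ne_top hle hT _ f hf).symm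
  have hint : ∀ f : α → ℂ, MeasureTheory.Integrable f m → c.Integrable f := fun f hf =>
    hf.of_measure_le_smul ENNReal.coe_ne_top hle
  rw [hrepr g hg]
  refine MeasureTheory.Integrable.induction (μ := m)
    (fun f : α → ℂ => setToFun m _ hT f = (∫ x, f x ∂m) * γ) ?_ ?_ ?_ ?_ hg
  · intro a s hs hms
    rw [setToFun_indicator_const _ hs hms.ne, integral_indicator_const _ hs]
    change a * c s = _
    rw [hc s hs, Complex.real_smul]
    ring
  · intro f h _ hf hh h1 h2
    rw [setToFun_add _ hf hh, h1, h2, ← add_mul]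
    congr 1
    exact (integral_add hf hh).symm
  · exact isClosed_eq (continuous_setToFun _) (continuous_integral.mul continuous_const)
  · intro f h hfh _ hf
    rw [← setToFun_congr_ae _ hfh, hf, integral_congr_ae hfh]

end ComplexMeasure

/-! ### The partition into shells. -/

section Shell

variable {n : ℕ}

theorem mem_shell_iff {k : ℕ} {x : Rn n} : x ∈ shell n k ↔ ⌊‖x‖⌋₊ = k := by
  rw [Nat.floor_eq_iff (norm_nonneg x)]; rfl

theorem iUnion_shell : ⋃ k, shell n k = univ :=
  eq_univ_of_forall fun x => mem_iUnion.2 ⟨⌊‖x‖⌋₊, mem_shell_iff.2 rfl⟩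

theorem pairwise_disjoint_shell : Pairwise (Function.onFun Disjoint (shell n)) :=
  fun _ _ h => disjoint_left.2 fun _ hi hj => h ((mem_shell_iff.1 hi).symm.trans (mem_shell_iff.1 hj))

theorem sum_restrict_shell (m : Measure (Rn n)) :
    Measure.sum (fun k => m.restrict (shell n k)) = m := by
  rw [← Measure.restrict_iUnion pairwise_disjoint_shell (measurableSet_shell n), iUnion_shell,
    Measure.restrict_univ]

end Shell

/-! ### Total variation and integrals of complex Radon measures. -/

namespace ComplexRadonMeasure

variable {n : ℕ}

theorem restrict_apply (μ : ComplexRadonMeasure n) {K : Set (Rn n)} (hK : MeasurableSet K)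
    (hb : Bornology.IsBounded K) {E : Set (Rn n)} (hE : MeasurableSet E) :
    μ.restrict K hK hb E = μ.toFun (E ∩ K) :=
  if_pos hE

theorem onShell_apply (μ : ComplexRadonMeasure n) (k : ℕ) {E : Set (Rn n)}
    (hE : MeasurableSet E) : μ.onShell k E = μ.toFun (E ∩ shell n k) :=
  μ.restrict_apply _ _ hE

theorem enorm_toFun_le (μ : ComplexRadonMeasure n) {B : Set (Rn n)} (hB : MeasurableSet B)
    (hb : Bornology.IsBounded B) : ‖μ.toFun B‖ₑ ≤ μ.variation B := by
  have hU : ⋃ k, B ∩ shell n k = B := by rw [← inter_iUnion, iUnion_shell, inter_univ]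
  have h := μ.hasSum_iUnion (fun k => B ∩ shell n k)
    (fun k => hB.inter (measurableSet_shell n k)) (by rwa [hU])
    (fun i j hij => (pairwise_disjoint_shell hij).mono inter_subset_right inter_subset_right)
  rw [hU] at h
  rw [variation, Measure.sum_apply _ hB, ← h.tsum_eq]
  refine enorm_tsum_le_tsum_enorm.trans (ENNReal.tsum_le_tsum fun k => ?_)
  rw [← μ.onShell_apply k hB]
  exact VectorMeasure.enorm_measure_le_variation _ _

/-- Frees the variation from the choice of shells: pieces of `B` inside a shell are measured alike
by `onShell` and by the restriction to `K`. The latter is a finite complex measure, so bounded sets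
have finite variation. -/
theorem variation_le_variation_restrict (μ : ComplexRadonMeasure n) {K : Set (Rn n)}
    (hK : MeasurableSet K) (hb : Bornology.IsBounded K) {B : Set (Rn n)} (hB : MeasurableSet B)
    (hBK : B ⊆ K) : μ.variation B ≤ (μ.restrict K hK hb).variation B := by
  rw [variation, Measure.sum_apply _ hB]
  conv_rhs => rw [← sum_restrict_shell (μ.restrict K hK hb).variation, Measure.sum_apply _ hB]
  refine ENNReal.tsum_le_tsum fun k => ?_
  refine VectorMeasure.variation_apply_le_of_forall_enorm_le hB fun E hE hEB => ?_
  rw [Measure.restrict_apply hE, μ.onShell_apply k hE]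
  have : E ∩ shell n k = (E ∩ shell n k) ∩ K :=
    (inter_eq_left.2 (inter_subset_left.trans (hEB.trans hBK))).symm
  conv_lhs => rw [this, ← μ.restrict_apply hK hb (hE.inter (measurableSet_shell n k))]
  exact VectorMeasure.enorm_measure_le_variation _ _

theorem variation_ball_lt_top (μ : ComplexRadonMeasure n) (x : Rn n) (r : ℝ) :
    μ.variation (Metric.ball x r) < ∞ :=
  (μ.variation_le_variation_restrict measurableSet_ball Metric.isBounded_ball measurableSet_ball
    Subset.rfl).trans_lt (measure_lt_top _ _)

instance (μ : ComplexRadonMeasure n) : IsLocallyFiniteMeasure μ.variation :=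
  ⟨fun x => ⟨Metric.ball x 1, Metric.ball_mem_nhds x one_pos, μ.variation_ball_lt_top x 1⟩⟩

theorem exists_subset_variation_le (μ : ComplexRadonMeasure n) {B : Set (Rn n)}
    (hB : MeasurableSet B) (hb : Bornology.IsBounded B) :
    ∃ A ⊆ B, MeasurableSet A ∧ μ.variation B ≤ 8 * ‖μ.toFun A‖ₑ := by
  obtain ⟨A, hAB, hA, h⟩ := MRAPaper.exists_subset_variation_le (μ.restrict B hB hb) hB
  rw [restrict_apply _ _ _ hA, inter_eq_left.2 hAB] at h
  exact ⟨A, hAB, hA, (μ.variation_le_variation_restrict hB hb hB Subset.rfl).trans h⟩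

theorem toFun_diff (μ : ComplexRadonMeasure n) {A B : Set (Rn n)} (hA : MeasurableSet A)
    (hB : MeasurableSet B) (hb : Bornology.IsBounded B) (hAB : A ⊆ B) :
    μ.toFun (B \ A) = μ.toFun B - μ.toFun A := by
  have h := (μ.restrict B hB hb).of_union (disjoint_sdiff_right (s := A) (t := B)) hA (hB.diff hA)
  rw [union_sdiff_cancel hAB, restrict_apply _ _ _ hB, restrict_apply _ _ _ hA,
    restrict_apply _ _ _ (hB.diff hA), inter_self, inter_eq_left.2 hAB,
    inter_eq_left.2 sdiff_subset] at h
  rw [h]; ring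

/-- The complex Radon measure `dμ - f dm`. -/
def subDensity (μ : ComplexRadonMeasure n) (f : Rn n → ℂ)
    (hf : LocallyIntegrable f (volume : Measure (Rn n))) : ComplexRadonMeasure n where
  toFun B := μ.toFun B - ∫ x in B, f x
  hasSum_iUnion B hB hb hd := (μ.hasSum_iUnion B hB hb hd).sub
    (hasSum_integral_iUnion hB hd
      ((hf.integrableOn_isCompact hb.isCompact_closure).mono_set subset_closure))

/-- Carries the polynomial growth of |μ| on balls over to μ − γ m. -/
theorem variation_subDensity_const_le (μ : ComplexRadonMeasure n) (γ : ℂ) :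
    (μ.subDensity (fun _ => γ) (locallyIntegrable_const γ)).variation ≤
      μ.variation + ‖γ‖ₑ • volume := by
  refine Measure.le_intro fun B hB _ => ?_
  conv_rhs => rw [← sum_restrict_shell (volume : Measure (Rn n))]
  rw [Measure.add_apply, Measure.smul_apply, variation, variation, Measure.sum_apply _ hB,
    Measure.sum_apply _ hB, Measure.sum_apply _ hB, smul_eq_mul, ← ENNReal.tsum_mul_left,
    ← ENNReal.tsum_add]
  refine ENNReal.tsum_le_tsum fun k => ?_
  refine (VectorMeasure.variation_le_of_forall_enorm_le (m := (μ.onShell k).variation +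
    ‖γ‖ₑ • volume.restrict (shell n k)) fun E hE => ?_) B
  rw [onShell_apply _ k hE, Measure.add_apply, Measure.smul_apply, Measure.restrict_apply hE]
  refine enorm_sub_le.trans (add_le_add ?_ ?_)
  · rw [← onShell_apply _ k hE]
    exact VectorMeasure.enorm_measure_le_variation _ _
  · refine (enorm_integral_le_lintegral_enorm _).trans ?_
    simp

theorem integral_subDensity_const (μ : ComplexRadonMeasure n) (γ : ℂ) {g : Rn n → ℂ}
    (hμ : μ.Integrable g) (hg : MeasureTheory.Integrable g volume) :
    (μ.subDensity (fun _ => γ) (locallyIntegrable_const γ)).integral g =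
      μ.integral g - (∫ x, g x) * γ := by
  have hfin : ∀ k, IsFiniteMeasure ((volume : Measure (Rn n)).restrict (shell n k)) := fun k =>
    ⟨by rw [Measure.restrict_apply_univ]; exact (isBounded_shell n k).measure_lt_top⟩
  -- Absolute convergence over the shells, dominated by ∫ ‖g‖ d|μ|; it allows the subtraction shell
  -- by shell.
  have hS : HasSum (fun k => (μ.onShell k).integral g (ContinuousLinearMap.mul ℝ ℂ))
      (μ.integral g) := by
    refine Summable.hasSum (Summable.of_norm_bounded
      (hasSum_integral_measure (f := fun x => ‖g x‖) (μ := fun k => (μ.onShell k).variation)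
        hμ.norm).summable fun k => ?_)
    refine (VectorMeasure.norm_integral_le_integral_norm).trans ?_
    exact mul_le_of_le_one_left (integral_nonneg fun _ => norm_nonneg _)
      (ContinuousLinearMap.opNorm_mul_le ℝ ℂ)
  have hV : HasSum (fun k => (∫ x in shell n k, g x) * γ) ((∫ x, g x) * γ) := by
    refine HasSum.mul_right _ ?_
    have := hasSum_integral_measure (f := g)
      (μ := fun k => (volume : Measure (Rn n)).restrict (shell n k))
      (by rwa [sum_restrict_shell])
    rwa [sum_restrict_shell] at this
  rw [← (hS.sub hV).tsum_eq]
  refine tsum_congr fun k => ?_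
  let c : ComplexMeasure (Rn n) := (volume.restrict (shell n k)).withDensityᵥ fun _ => γ
  have hc : ∀ s, MeasurableSet s → c s = (volume.restrict (shell n k)).real s * γ := fun s hs => by
    have := hfin k
    rw [withDensityᵥ_apply (integrable_const γ) hs, setIntegral_const, Complex.real_smul]
  have hgk : MeasureTheory.Integrable g (volume.restrict (shell n k)) := hg.restrict
  have := hfin k
  rw [← integral_eq_of_eq_mul c _ γ hc hgk, ← VectorMeasure.integral_sub_vectorMeasure]
  · congr 1
    ext E hE
    rw [sub_apply, onShell_apply _ k hE, onShell_apply _ k hE, hc E hE]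
    simp [subDensity, Measure.real, Measure.restrict_apply hE]
  · exact hμ.mono_measure (Measure.le_sum _ k)
  · refine hgk.of_measure_le_smul (c := ‖γ‖ₑ) enorm_ne_top
      (VectorMeasure.variation_le_of_forall_enorm_le fun E hE => ?_)
    rw [hc E hE, enorm_mul, Measure.smul_apply, smul_eq_mul, mul_comm]
    refine mul_le_mul' le_rfl (le_of_eq ?_)
    rw [← ofReal_norm, Complex.norm_real, Real.norm_of_nonneg measureReal_nonneg]
    exact ofReal_measureReal

theorem enorm_integral_le (μ : ComplexRadonMeasure n) (g : Rn n → ℂ) :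
    ‖μ.integral g‖ₑ ≤ ∫⁻ x, ‖g x‖ₑ ∂μ.variation := by
  rw [variation, lintegral_sum_measure]
  refine enorm_tsum_le_tsum_enorm.trans (ENNReal.tsum_le_tsum fun k => ?_)
  refine (VectorMeasure.enorm_integral_le_lintegral_enorm).trans (mul_le_of_le_one_left' ?_)
  rw [← ofReal_norm]
  exact ENNReal.ofReal_le_one.2 (ContinuousLinearMap.opNorm_mul_le ℝ ℂ)

end ComplexRadonMeasure

/-! ### Existence of the Lebesgue decomposition. -/

section LebesgueDecomposition

variable {α : Type*} [MeasurableSpace α]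

theorem variation_singularPart_mutuallySingular (c : ComplexMeasure α) (m : Measure α) :
    (c.singularPart m).variation ⟂ₘ m := by
  have h : ∀ s : SignedMeasure α, (s.singularPart m).variation ⟂ₘ m := fun s => by
    have := SignedMeasure.mutuallySingular_singularPart s m
    rwa [SignedMeasure.mutuallySingular_ennreal_iff,
      VectorMeasure.ennrealToMeasure_toENNRealVectorMeasure,
      SignedMeasure.totalVariation_eq_variation] at this
  have h' := (h (ComplexMeasure.re c)).add_left (h (ComplexMeasure.im c))
  exact h'.mono_ac (variation_le_re_add_im (c.singularPart m)).absolutelyContinuous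
    Measure.AbsolutelyContinuous.rfl

theorem complexMeasure_apply_eq_singularPart_add (c : ComplexMeasure α) (m : Measure α)
    [SigmaFinite m] {s : Set α} (hs : MeasurableSet s) :
    c s = c.singularPart m s + ∫ x in s, c.rnDeriv m x ∂m := by
  have : c.HaveLebesgueDecomposition m := ⟨inferInstance, inferInstance⟩
  conv_lhs => rw [← ComplexMeasure.singularPart_add_withDensity_rnDeriv_eq (c := c) (μ := m)]
  rw [add_apply, withDensityᵥ_apply (c.integrable_rnDeriv m) hs]

variable {n : ℕ}

theorem ball_subset_iUnion_shell (r : ℝ) :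
    Metric.ball (0 : Rn n) r ⊆ ⋃ k ∈ Finset.range (⌊r⌋₊ + 1), shell n k := fun x hx => by
  refine mem_biUnion (x := ⌊‖x‖⌋₊) ?_ (mem_shell_iff.2 rfl)
  have : ‖x‖ ≤ r := (mem_ball_zero_iff.1 hx).le
  exact Finset.mem_range.2 (Nat.lt_succ_of_le (Nat.floor_le_floor this))

theorem locallyIntegrable_of_integrableOn_shell {f : Rn n → ℂ}
    (hf : ∀ k, IntegrableOn f (shell n k)) : LocallyIntegrable f := by
  intro x
  refine ⟨Metric.ball 0 (‖x‖ + 1), Metric.isOpen_ball.mem_nhds (by simp), ?_⟩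
  exact ((integrableOn_finset_iUnion (s := Finset.range (⌊‖x‖ + 1⌋₊ + 1))).2
    fun k _ => hf k).mono_set (ball_subset_iUnion_shell _)

/-- Existence of the Lebesgue decomposition of a complex Radon measure. -/
theorem ComplexRadonMeasure.exists_isLebesgueDecomposition (μ : ComplexRadonMeasure n) :
    ∃ (f : Rn n → ℂ) (μs : ComplexRadonMeasure n), μ.IsLebesgueDecomposition f μs := by
  -- The densities on the shells are glued: ⌊‖x‖⌋₊ is the index of the shell containing `x`.
  let f : Rn n → ℂ := fun x => (μ.onShell ⌊‖x‖⌋₊).rnDeriv volume x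
  have hfk : ∀ k, ∀ x ∈ shell n k, f x = (μ.onShell k).rnDeriv volume x := fun k x hx => by
    simp only [f, mem_shell_iff.1 hx]
  have hf : LocallyIntegrable f := locallyIntegrable_of_integrableOn_shell fun k =>
    ((μ.onShell k).integrable_rnDeriv volume).integrableOn.congr_fun
      (fun x hx => (hfk k x hx).symm) (measurableSet_shell n k)
  -- With μₛ defined as μ − f dm, only singularity is left; on each shell μₛ is the singular part of
  -- `onShell`.
  refine ⟨f, μ.subDensity f hf, hf, ?_, fun B _ _ => by simp [subDensity]⟩
  refine Measure.MutuallySingular.sum_left.2 fun k => ?_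
  refine (variation_singularPart_mutuallySingular (μ.onShell k) volume).mono_ac
    (Measure.AbsolutelyContinuous.trans (Measure.absolutelyContinuous_of_le
      (ν := (((μ.onShell k).singularPart volume).variation).restrict (shell n k)) ?_)
      (Measure.absolutelyContinuous_of_le Measure.restrict_le_self))
    Measure.AbsolutelyContinuous.rfl
  refine VectorMeasure.variation_le_of_forall_enorm_le fun E hE => ?_
  have hEk := hE.inter (measurableSet_shell n k)
  have key : (μ.subDensity f hf).onShell k E = (μ.onShell k).singularPart volume (E ∩ shell n k) := by
    have h := complexMeasure_apply_eq_singularPart_add (μ.onShell k) volume hEk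
    rw [onShell_apply _ k hEk, inter_assoc, inter_self] at h
    rw [onShell_apply _ k hE]
    change μ.toFun (E ∩ shell n k) - ∫ x in E ∩ shell n k, f x = _
    rw [h, setIntegral_congr_fun hEk fun x hx => hfk k x hx.2]
    ring
  rw [key, Measure.restrict_apply hE]
  exact VectorMeasure.enorm_measure_le_variation _ _

end LebesgueDecomposition

/-! ### Lebesgue differentiation along regularly shrinking sets. -/

section Differentiation

variable {n : ℕ}

theorem volume_real_ball (x : Rn n) {r : ℝ} (hr : 0 < r) :
    volume.real (Metric.ball x r) = r ^ n * volume.real (Metric.ball (0 : Rn n) 1) := by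
  rw [Measure.real, Measure.addHaar_ball_of_pos _ _ hr, ENNReal.toReal_mul,
    ENNReal.toReal_ofReal (by positivity), finrank_euclideanSpace_fin, Measure.real]

theorem volume_real_closedBall (x : Rn n) {r : ℝ} (hr : 0 < r) :
    volume.real (Metric.closedBall x r) = r ^ n * volume.real (Metric.ball (0 : Rn n) 1) := by
  rw [Measure.real, Measure.addHaar_closedBall _ _ hr.le, ENNReal.toReal_mul,
    ENNReal.toReal_ofReal (by positivity), finrank_euclideanSpace_fin, Measure.real]

theorem volume_real_unitBall_pos : 0 < volume.real (Metric.ball (0 : Rn n) 1) :=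
  ENNReal.toReal_pos (Metric.measure_ball_pos _ _ one_pos).ne' measure_ball_lt_top.ne

/-- Lebesgue's differentiation theorem for complex Radon measures. -/
theorem ComplexRadonMeasure.IsLebesgueDecomposition.ae_isLebesgueDensityPoint
    {μ : ComplexRadonMeasure n} {f : Rn n → ℂ} {μs : ComplexRadonMeasure n}
    (h : μ.IsLebesgueDecomposition f μs) :
    ∀ᵐ x, IsLebesgueDensityPoint μ x (f x) := by
  let v := IsUnifLocDoublingMeasure.vitaliFamily (volume : Measure (Rn n)) 1
  filter_upwards [v.ae_tendsto_average_norm_sub h.locallyIntegrable,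
    v.ae_eventually_measure_zero_of_singular h.mutuallySingular] with x hx1 hx2
  rintro B ⟨hBm, ε, hε, hε0, hBε, a, ha, hav⟩
  have hlim : Tendsto ε atTop (𝓝[>] 0) :=
    tendsto_nhdsWithin_iff.2 ⟨hε0, Eventually.of_forall hε⟩
  have hF : Tendsto (fun ν => Metric.closedBall x (ε ν)) atTop (v.filterAt x) :=
    IsUnifLocDoublingMeasure.tendsto_closedBall_filterAt volume (fun _ => x) ε hlim
      (Eventually.of_forall fun ν => by simpa using (hε ν).le)
  have h1 := hx1.comp hF
  have h2 := (ENNReal.tendsto_toReal ENNReal.zero_ne_top).comp (hx2.comp hF)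
  set c := volume.real (Metric.ball (0 : Rn n) 1) with hc
  have hc0 : 0 < c := volume_real_unitBall_pos
  -- Regular shrinking gives m(closed ball) = c εⁿ ≤ (c / a) m(B_ν), the price of replacing B_ν by
  -- the ball.
  have h3 := ((h1.add h2).const_mul (c / a))
  simp only [ENNReal.toReal_zero, add_zero, mul_zero] at h3
  rw [tendsto_iff_norm_sub_tendsto_zero]
  refine squeeze_zero (fun _ => norm_nonneg _) (fun ν => ?_) h3
  have hBb : Bornology.IsBounded (B ν) := Metric.isBounded_ball.subset (hBε ν)
  have hεn : 0 < ε ν ^ n := pow_pos (hε ν) n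
  have hm : 0 < volume.real (B ν) := (mul_pos ha hεn).trans_le (hav ν)
  have hBc : B ν ⊆ Metric.closedBall x (ε ν) := (hBε ν).trans Metric.ball_subset_closedBall
  have hfi : IntegrableOn f (Metric.closedBall x (ε ν)) :=
    h.locallyIntegrable.integrableOn_isCompact (isCompact_closedBall _ _)
  have hci : IntegrableOn (fun _ => f x) (Metric.closedBall x (ε ν)) :=
    integrableOn_const measure_closedBall_lt_top.ne
  have hm' : (volume.real (B ν) : ℂ) ≠ 0 := by exact_mod_cast hm.ne'
  -- The error splits into the oscillation of `f` and the singular mass, each bounded by its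
  -- analogue on the closed ball.
  have e1 : μ.toFun (B ν) / (volume.real (B ν) : ℂ) - f x =
      ((∫ y in B ν, (f y - f x)) + μs.toFun (B ν)) / (volume.real (B ν) : ℂ) := by
    rw [integral_sub (hfi.mono_set hBc) (hci.mono_set hBc), setIntegral_const,
      h.eq_add _ (hBm ν) hBb, Complex.real_smul]
    field_simp
    ring
  have hi1 : ‖∫ y in B ν, (f y - f x)‖ ≤ ∫ y in Metric.closedBall x (ε ν), ‖f y - f x‖ :=
    (norm_integral_le_integral_norm _).trans (setIntegral_mono_set (hfi.sub hci).norm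
      (Eventually.of_forall fun _ => norm_nonneg _) hBc.eventuallyLE)
  have hfin : μs.variation (Metric.closedBall x (ε ν)) ≠ ∞ :=
    (isCompact_closedBall _ _).measure_lt_top.ne
  have hi2 : ‖μs.toFun (B ν)‖ ≤ μs.variation.real (Metric.closedBall x (ε ν)) := by
    rw [← toReal_enorm]
    exact ENNReal.toReal_mono hfin ((μs.enorm_toFun_le (hBm ν) hBb).trans (measure_mono hBc))
  have hvol := volume_real_closedBall x (hε ν)
  rw [← hc] at hvol
  simp only [Function.comp_apply, setAverage_eq, smul_eq_mul, ENNReal.toReal_div]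
  rw [← Measure.real, ← Measure.real, hvol, e1, norm_div, Complex.norm_real, Real.norm_of_nonneg hm.le]
  calc _ ≤ ((∫ y in Metric.closedBall x (ε ν), ‖f y - f x‖) +
        μs.variation.real (Metric.closedBall x (ε ν))) / (a * ε ν ^ n) := by
        gcongr
        · exact (norm_add_le _ _).trans (add_le_add hi1 hi2)
        · exact hav ν
    _ = _ := by field_simp

end Differentiation

/-! ### Density points and concentrating kernels. -/

section Density

variable {n : ℕ}

theorem ShrinksRegularly.volume_real_pos {B : ℕ → Set (Rn n)} {x₀ : Rn n}
    (h : ShrinksRegularly B x₀) (ν : ℕ) : 0 < volume.real (B ν) := by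
  obtain ⟨_, ε, hε, _, _, a, ha, hB⟩ := h
  exact (mul_pos ha (pow_pos (hε ν) n)).trans_le (hB ν)

theorem IsLebesgueDensityPoint.subDensity_const {μ : ComplexRadonMeasure n} {x₀ : Rn n} {γ : ℂ}
    (h : IsLebesgueDensityPoint μ x₀ γ) :
    IsLebesgueDensityPoint (μ.subDensity (fun _ => γ) (locallyIntegrable_const γ)) x₀ 0 := by
  intro B hB
  have := (h B hB).sub_const γ
  rw [sub_self] at this
  refine this.congr fun ν => ?_
  have hm : (volume.real (B ν) : ℂ) ≠ 0 := by exact_mod_cast (hB.volume_real_pos ν).ne'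
  simp only [ComplexRadonMeasure.subDensity, setIntegral_const, Complex.real_smul]
  field_simp

/-- At a density point with value zero, the total variation of balls is negligible too. -/
theorem IsLebesgueDensityPoint.tendsto_variation_ball {σ : ComplexRadonMeasure n} {x₀ : Rn n}
    (h : IsLebesgueDensityPoint σ x₀ 0) :
    Tendsto (fun r : ℝ => σ.variation.real (Metric.ball x₀ r) / r ^ n) (𝓝[>] 0) (𝓝 0) := by
  set c := volume.real (Metric.ball (0 : Rn n) 1) with hc
  have hc0 : 0 < c := volume_real_unitBall_pos
  have main : ∀ ε : ℕ → ℝ, (∀ ν, 0 < ε ν) → Tendsto ε atTop (𝓝 0) →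
      Tendsto (fun ν => σ.variation.real (Metric.ball x₀ (ε ν)) / ε ν ^ n) atTop (𝓝 0) := by
    intro ε hε hε0
    have hex : ∀ ν, ∃ A ⊆ Metric.ball x₀ (ε ν), MeasurableSet A ∧
        σ.variation (Metric.ball x₀ (ε ν)) ≤ 8 * ‖σ.toFun A‖ₑ := fun ν =>
      σ.exists_subset_variation_le measurableSet_ball Metric.isBounded_ball
    choose A hAB hA hvar using hex
    have hvol : ∀ ν, volume.real (Metric.ball x₀ (ε ν)) = ε ν ^ n * c := fun ν =>
      volume_real_ball x₀ (hε ν)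
    -- The set `A` may be too thin to shrink regularly. Then its complement in the ball has at least
    -- half the volume, and σ(A) = σ(ball) − σ(ball \ A).
    have hD : ∀ ν, ∃ D ⊆ Metric.ball x₀ (ε ν), MeasurableSet D ∧
        c / 2 * ε ν ^ n ≤ volume.real D ∧
        ‖σ.toFun (A ν)‖ ≤ ‖σ.toFun D‖ + ‖σ.toFun (Metric.ball x₀ (ε ν))‖ := by
      intro ν
      by_cases hbig : c / 2 * ε ν ^ n ≤ volume.real (A ν)
      · exact ⟨A ν, hAB ν, hA ν, hbig, le_add_of_nonneg_right (norm_nonneg _)⟩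
      · refine ⟨Metric.ball x₀ (ε ν) \ A ν, sdiff_subset, measurableSet_ball.diff (hA ν), ?_, ?_⟩
        · rw [measureReal_sdiff (hAB ν) (hA ν) (measure_ball_lt_top.ne), hvol]
          push Not at hbig
          linarith
        · rw [σ.toFun_diff (hA ν) measurableSet_ball Metric.isBounded_ball (hAB ν)]
          have := norm_sub_norm_le (σ.toFun (A ν)) (σ.toFun (Metric.ball x₀ (ε ν)))
          rw [norm_sub_rev] at this
          linarith
    choose D hDB hDm hDvol hle using hD
    have sD : ShrinksRegularly D x₀ := ⟨hDm, ε, hε, hε0, hDB, c / 2, half_pos hc0, hDvol⟩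
    have sB : ShrinksRegularly (fun ν => Metric.ball x₀ (ε ν)) x₀ :=
      ⟨fun _ => measurableSet_ball, ε, hε, hε0, fun _ => Subset.rfl, c, hc0, fun ν => by
        rw [hvol, mul_comm]⟩
    have hlim := (((h D sD).norm.add (h _ sB).norm).const_mul (8 * c))
    simp only [norm_zero, add_zero, mul_zero] at hlim
    refine squeeze_zero (fun ν => div_nonneg measureReal_nonneg (pow_pos (hε ν) n).le)
      (fun ν => ?_) hlim
    have hεn : 0 < ε ν ^ n := pow_pos (hε ν) n
    have h1 : σ.variation.real (Metric.ball x₀ (ε ν)) ≤ 8 * ‖σ.toFun (A ν)‖ := by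
      have := ENNReal.toReal_mono (by finiteness) (hvar ν)
      simpa [Measure.real] using this
    have hDle : volume.real (D ν) ≤ ε ν ^ n * c := by
      rw [← hvol]
      exact measureReal_mono (hDB ν) measure_ball_lt_top.ne
    have hDpos := sD.volume_real_pos ν
    rw [norm_div, norm_div, Complex.norm_real, Complex.norm_real,
      Real.norm_of_nonneg measureReal_nonneg, Real.norm_of_nonneg measureReal_nonneg, hvol]
    rw [div_le_iff₀ hεn]
    have h2 : ‖σ.toFun (D ν)‖ ≤ ε ν ^ n * c * (‖σ.toFun (D ν)‖ / volume.real (D ν)) := by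
      calc ‖σ.toFun (D ν)‖ = volume.real (D ν) * (‖σ.toFun (D ν)‖ / volume.real (D ν)) := by
            field_simp
        _ ≤ _ := by gcongr
    have h3 : ‖σ.toFun (Metric.ball x₀ (ε ν))‖ =
        ε ν ^ n * c * (‖σ.toFun (Metric.ball x₀ (ε ν))‖ / (ε ν ^ n * c)) := by
      field_simp
    calc _ ≤ 8 * (‖σ.toFun (D ν)‖ + ‖σ.toFun (Metric.ball x₀ (ε ν))‖) := by linarith [hle ν]
      _ ≤ 8 * (ε ν ^ n * c * (‖σ.toFun (D ν)‖ / volume.real (D ν)) +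
          ε ν ^ n * c * (‖σ.toFun (Metric.ball x₀ (ε ν))‖ / (ε ν ^ n * c))) := by
        rw [← h3]; linarith
      _ = _ := by ring
  -- `main` wants positive radii throughout, whereas `u` is only eventually positive; the other
  -- terms are replaced by 1.
  refine tendsto_of_seq_tendsto fun u hu => ?_
  obtain ⟨hu0, hupos⟩ := tendsto_nhdsWithin_iff.1 hu
  have hcongr : (fun ν => if 0 < u ν then u ν else 1) =ᶠ[atTop] u :=
    hupos.mono fun ν hν => if_pos hν
  refine (main (fun ν => if 0 < u ν then u ν else 1) (fun ν => ?_)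
    (hu0.congr' hcongr.symm)).congr' (hcongr.mono fun ν hν => by simp only [Function.comp, hν])
  split_ifs with h0
  exacts [h0, one_pos]

/-- A dyadic majorant of a negative power. -/
theorem one_div_one_add_pow_le_tsum (L : ℕ) {t : ℝ} (ht : 0 ≤ t) :
    ENNReal.ofReal (1 / (1 + t) ^ L) ≤
      ∑' k : ℕ, if t < 2 ^ k then ENNReal.ofReal (2 ^ L * (1 / 2 ^ L) ^ k) else 0 := by
  classical
  have hex : ∃ k : ℕ, t < 2 ^ k := pow_unbounded_of_one_lt t one_lt_two
  -- Only the least k with t < 2^k is kept. For k > 0 minimality gives 2^(k-1) ≤ t, and the factor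
  -- 2^L absorbs the shift by one.
  refine le_trans ?_ (ENNReal.le_tsum (Nat.find hex))
  rw [if_pos (Nat.find_spec hex)]
  refine ENNReal.ofReal_le_ofReal ?_
  rcases Nat.eq_zero_or_pos (Nat.find hex) with h0 | hpos
  · rw [h0, pow_zero, mul_one]
    calc 1 / (1 + t) ^ L ≤ 1 := by
          rw [div_le_one (by positivity)]
          exact one_le_pow₀ (by linarith)
      _ ≤ 2 ^ L := one_le_pow₀ one_le_two
  · obtain ⟨k, hk⟩ := Nat.exists_eq_succ_of_ne_zero hpos.ne'
    have hlt : (2 : ℝ) ^ k ≤ t := not_lt.1 (Nat.find_min hex (by omega))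
    rw [hk]
    calc 1 / (1 + t) ^ L ≤ 1 / (2 ^ k) ^ L := by
          gcongr
          linarith
      _ = _ := by
        rw [pow_succ, one_div_pow, ← pow_mul, ← pow_mul, mul_comm]
        field_simp

/-- A measure of polynomial growth, negligible near `x₀`, tested against a concentrating family. -/
theorem tendsto_lintegral_concentrating {ν : Measure (Rn n)} {x₀ : Rn n} {A : ℝ} {K L : ℕ}
    (hgrow : ∀ r : ℝ, 0 < r → ν (Metric.ball x₀ r) ≤ ENNReal.ofReal (A * (1 + r) ^ K))
    (hzero : Tendsto (fun r : ℝ => ν.real (Metric.ball x₀ r) / r ^ n) (𝓝[>] 0) (𝓝 0))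
    (hL : n + K + 1 ≤ L) :
    Tendsto (fun j : ℕ => ∫⁻ y, ENNReal.ofReal
      ((2 : ℝ) ^ (n * j) * (1 / (1 + 2 ^ j * ‖x₀ - y‖) ^ L)) ∂ν) atTop (𝓝 0) := by
  set G : ℝ → ℝ := fun r => ν.real (Metric.ball x₀ r) / r ^ n with hG
  have hG0 : ∀ r, 0 < r → 0 ≤ G r := fun r hr => by positivity
  have hfin : ∀ r, 0 < r → ν (Metric.ball x₀ r) ≠ ∞ := fun r hr =>
    ((hgrow r hr).trans_lt ENNReal.ofReal_lt_top).ne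
  obtain ⟨δ, hδ, hδG⟩ : ∃ δ > 0, ∀ r, 0 < r → r < δ → G r ≤ 1 := by
    have := hzero.eventually (ge_mem_nhds (zero_lt_one))
    obtain ⟨δ, hδ, h⟩ := mem_nhdsGT_iff_exists_Ioo_subset.1 this
    exact ⟨δ, hδ, fun r h0 h1 => h ⟨h0, h1⟩⟩
  have hA : 0 ≤ |A| / δ ^ n := by positivity
  -- Below δ the ratio is at most 1; beyond δ the growth hypothesis is divided by δⁿ.
  have hGb : ∀ r, 0 < r → G r ≤ (1 + |A| / δ ^ n) * (1 + r) ^ K := by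
    intro r hr
    have h1 : (1 : ℝ) ≤ (1 + r) ^ K := one_le_pow₀ (by linarith)
    rcases lt_or_ge r δ with h | h
    · nlinarith [hδG r hr h]
    · have hν : ν.real (Metric.ball x₀ r) ≤ |A| * (1 + r) ^ K := by
        have : ν (Metric.ball x₀ r) ≤ ENNReal.ofReal (|A| * (1 + r) ^ K) :=
          (hgrow r hr).trans (ENNReal.ofReal_le_ofReal (by gcongr; exact le_abs_self A))
        exact ENNReal.toReal_le_of_le_ofReal (by positivity) this
      calc G r ≤ |A| * (1 + r) ^ K / δ ^ n := by
            simp only [hG]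
            gcongr
        _ = |A| / δ ^ n * (1 + r) ^ K := by ring
        _ ≤ _ := by gcongr; linarith
  -- The contribution of the ball of radius r = 2^k / 2^j: here 2^{nj} rⁿ = 2^{nk}, so `j` survives
  -- only in the argument of `G`.
  let a : ℕ → ℕ → ℝ := fun j k => 2 ^ L * (2 ^ n * (1 / 2 ^ L)) ^ k * G (2 ^ k / 2 ^ j)
  have ha0 : ∀ j k, 0 ≤ a j k := fun j k => by
    have := hG0 (2 ^ k / 2 ^ j) (by positivity)
    positivity
  set M := 2 ^ L * ((1 + |A| / δ ^ n) * 2 ^ K) with hM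
  -- The condition on `L` makes 2^{n + K − L} ≤ 1/2, a geometric bound uniform in `j`. Each fixed
  -- term tends to 0 because its radius does, so dominated convergence for series applies.
  have hbound : ∀ j k, a j k ≤ M * (1 / 2) ^ k := by
    intro j k
    have hr : (2 : ℝ) ^ k / 2 ^ j ≤ 2 ^ k := div_le_self (by positivity) (one_le_pow₀ one_le_two)
    have h1 : (1 : ℝ) + 2 ^ k / 2 ^ j ≤ 2 * 2 ^ k := by
      have : (1 : ℝ) ≤ 2 ^ k := one_le_pow₀ one_le_two
      linarith
    have h2 : (2 : ℝ) ^ n * (1 / 2 ^ L) * 2 ^ K ≤ 1 / 2 := by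
      have : (2 : ℝ) ^ (n + K + 1) ≤ 2 ^ L := pow_le_pow_right₀ one_le_two hL
      rw [mul_one_div, div_mul_eq_mul_div, div_le_div_iff₀ (by positivity) (by positivity)]
      calc (2 : ℝ) ^ n * 2 ^ K * 2 = 2 ^ (n + K + 1) := by ring
        _ ≤ _ := by linarith
    calc a j k ≤ 2 ^ L * (2 ^ n * (1 / 2 ^ L)) ^ k * ((1 + |A| / δ ^ n) * (2 * 2 ^ k) ^ K) := by
          refine mul_le_mul_of_nonneg_left ((hGb _ (by positivity)).trans ?_) (by positivity)
          gcongr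
      _ = M * (2 ^ n * (1 / 2 ^ L) * 2 ^ K) ^ k := by
          rw [hM, mul_pow (2 ^ n * (1 / 2 ^ L) : ℝ), mul_pow (2 : ℝ) (2 ^ k), ← pow_mul, ← pow_mul,
            mul_comm K k]
          ring
      _ ≤ _ := by gcongr
  have hsum : Summable fun k : ℕ => M * (1 / 2 : ℝ) ^ k :=
    (summable_geometric_of_lt_one (by norm_num) (by norm_num)).mul_left M
  have hasum : ∀ j, Summable (a j) := fun j => Summable.of_nonneg_of_le (ha0 j) (hbound j) hsum
  have hlim : Tendsto (fun j => ∑' k, a j k) atTop (𝓝 0) := by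
    have := tendsto_tsum_of_dominated_convergence (𝓕 := atTop) (f := a) (g := fun _ => 0) hsum
      (fun k => ?_) (Eventually.of_forall fun j k => by
        rw [Real.norm_of_nonneg (ha0 j k)]; exact hbound j k)
    · simpa using this
    · have hr : Tendsto (fun j : ℕ => (2 : ℝ) ^ k / 2 ^ j) atTop (𝓝[>] 0) :=
        tendsto_nhdsWithin_iff.2 ⟨(tendsto_pow_atTop_atTop_of_one_lt one_lt_two).const_div_atTop _,
          Eventually.of_forall fun j => by simp only [mem_Ioi]; positivity⟩
      have h := (hzero.comp hr).const_mul (2 ^ L * (2 ^ n * (1 / 2 ^ L) : ℝ) ^ k)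
      rwa [mul_zero] at h
  have hlim' : Tendsto (fun j => ENNReal.ofReal (∑' k, a j k)) atTop (𝓝 0) := by
    simpa using ENNReal.tendsto_ofReal hlim
  refine tendsto_of_tendsto_of_tendsto_of_le_of_le tendsto_const_nhds hlim'
    (fun _ => bot_le) fun j => ?_
  dsimp only
  have hpt : ∀ y, ENNReal.ofReal ((2 : ℝ) ^ (n * j) * (1 / (1 + 2 ^ j * ‖x₀ - y‖) ^ L)) ≤
      ∑' k : ℕ, (Metric.ball x₀ (2 ^ k / 2 ^ j)).indicator (fun _ =>
        ENNReal.ofReal (2 ^ (n * j) * (2 ^ L * (1 / 2 ^ L) ^ k))) y := by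
    intro y
    rw [ENNReal.ofReal_mul (by positivity)]
    refine (mul_le_mul' le_rfl (one_div_one_add_pow_le_tsum L
      (by positivity : 0 ≤ 2 ^ j * ‖x₀ - y‖))).trans ?_
    rw [← ENNReal.tsum_mul_left]
    refine ENNReal.tsum_le_tsum fun k => ?_
    have hiff : 2 ^ j * ‖x₀ - y‖ < 2 ^ k ↔ y ∈ Metric.ball x₀ (2 ^ k / 2 ^ j) := by
      rw [mem_ball_iff_norm', lt_div_iff₀ (by positivity), mul_comm]
    by_cases hy : y ∈ Metric.ball x₀ (2 ^ k / 2 ^ j)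
    · rw [if_pos (hiff.2 hy), indicator_of_mem hy, ← ENNReal.ofReal_mul (by positivity)]
    · rw [if_neg (fun h => hy (hiff.1 h)), mul_zero]
      exact bot_le
  refine (lintegral_mono hpt).trans ?_
  rw [lintegral_tsum fun k => (measurable_const.indicator measurableSet_ball).aemeasurable,
    ENNReal.ofReal_tsum_of_nonneg (ha0 j) (hasum j)]
  refine ENNReal.tsum_le_tsum fun k => ?_
  rw [lintegral_indicator_const measurableSet_ball,
    ← ENNReal.ofReal_toReal (hfin (2 ^ k / 2 ^ j) (by positivity)),
    ← ENNReal.ofReal_mul (by positivity)]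
  refine ENNReal.ofReal_le_ofReal (le_of_eq ?_)
  simp only [a, hG, Measure.real, div_pow, mul_pow, pow_mul]
  field_simp
  ring

end Density

/-! ### Lattice sums. -/

section Lattice

variable {n : ℕ}

theorem one_le_dist_latticePoint {m k : Fin n → ℤ} (h : m ≠ k) :
    1 ≤ dist (latticePoint m) (latticePoint k) := by
  obtain ⟨i, hi⟩ := Function.ne_iff.1 h
  rw [dist_eq_norm]
  refine le_trans ?_ (PiLp.norm_apply_le (latticePoint m - latticePoint k) i)
  have : (1 : ℤ) ≤ |m i - k i| := Int.one_le_abs (sub_ne_zero.2 hi)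
  simp only [latticePoint, PiLp.sub_apply, Real.norm_eq_abs]
  exact_mod_cast this

theorem pairwise_disjoint_ball_latticePoint (x : Rn n) {r : ℝ} (hr : r ≤ 1 / 2) :
    Pairwise (Function.onFun Disjoint fun m : Fin n → ℤ => Metric.ball (x + latticePoint m) r) :=
  fun m k h => Metric.ball_disjoint_ball (by
    rw [dist_add_left]
    linarith [one_le_dist_latticePoint h])

theorem integrable_one_div_one_add_norm_pow :
    MeasureTheory.Integrable (fun x : Rn n => 1 / (1 + ‖x‖) ^ (n + 1)) := by
  have h := integrable_one_add_norm (E := Rn n) (μ := volume) (r := (n + 1 : ℕ)) (by simp)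
  refine h.congr (Eventually.of_forall fun x => ?_)
  simp only
  rw [Real.rpow_neg (by positivity), Real.rpow_natCast, one_div]

/-- Comparison with an integral: the balls of radius 1/2 about lattice points are disjoint, and on
each one 1 + |x − y| ≤ (3/2)(1 + |x − m|). Translation invariance of the integral makes the bound
uniform in `x`. -/
theorem exists_tsum_lattice_le (n : ℕ) : ∃ S : ℝ, 0 ≤ S ∧ ∀ x : Rn n,
    Summable (fun m : Fin n → ℤ => 1 / (1 + ‖x - latticePoint m‖) ^ (n + 1)) ∧
      ∑' m : Fin n → ℤ, 1 / (1 + ‖x - latticePoint m‖) ^ (n + 1) ≤ S := by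
  set I : ℝ≥0∞ := ∫⁻ y : Rn n, ENNReal.ofReal (1 / (1 + ‖y‖) ^ (n + 1)) with hI
  have hItop : I ≠ ∞ := by
    have := (integrable_one_div_one_add_norm_pow (n := n)).lintegral_lt_top
    exact this.ne
  set b := volume (Metric.ball (0 : Rn n) (1 / 2)) with hb
  have hb0 : b ≠ 0 := (Metric.measure_ball_pos _ _ (by norm_num)).ne'
  have hbtop : b ≠ ∞ := measure_ball_lt_top.ne
  set S : ℝ≥0∞ := ENNReal.ofReal ((3 / 2) ^ (n + 1)) * I / b with hS
  have hStop : S ≠ ∞ := ENNReal.div_ne_top (ENNReal.mul_ne_top ENNReal.ofReal_ne_top hItop) hb0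
  have key : ∀ x : Rn n, ∑' m : Fin n → ℤ,
      ENNReal.ofReal (1 / (1 + ‖x - latticePoint m‖) ^ (n + 1)) ≤ S := by
    intro x
    rw [hS, ENNReal.le_div_iff_mul_le (Or.inl hb0) (Or.inl hbtop), ← ENNReal.tsum_mul_right]
    calc ∑' m : Fin n → ℤ, ENNReal.ofReal (1 / (1 + ‖x - latticePoint m‖) ^ (n + 1)) * b
        ≤ ∑' m : Fin n → ℤ, ∫⁻ y in Metric.ball (0 + latticePoint m) (1 / 2),
          ENNReal.ofReal ((3 / 2) ^ (n + 1)) * ENNReal.ofReal (1 / (1 + ‖x - y‖) ^ (n + 1)) := by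
          refine ENNReal.tsum_le_tsum fun m => ?_
          have hbm : b = volume (Metric.ball (0 + latticePoint m : Rn n) (1 / 2)) := by
            rw [hb, Measure.addHaar_ball_center, ← Measure.addHaar_ball_center volume
              (0 + latticePoint m : Rn n)]
          rw [hbm, ← setLIntegral_const]
          refine setLIntegral_mono' measurableSet_ball fun y hy => ?_
          rw [← ENNReal.ofReal_mul (by positivity)]
          refine ENNReal.ofReal_le_ofReal ?_
          rw [zero_add, mem_ball_iff_norm'] at hy
          have h1 : ‖x - y‖ ≤ ‖x - latticePoint m‖ + ‖latticePoint m - y‖ :=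
            norm_sub_le_norm_sub_add_norm_sub _ _ _
          have h2 : 1 + ‖x - y‖ ≤ 3 / 2 * (1 + ‖x - latticePoint m‖) := by
            linarith [norm_nonneg (x - latticePoint m)]
          rw [mul_one_div, div_le_div_iff₀ (by positivity) (by positivity), one_mul, ← mul_pow]
          exact pow_le_pow_left₀ (by positivity) h2 _
      _ = ∫⁻ y in ⋃ m : Fin n → ℤ, Metric.ball (0 + latticePoint m) (1 / 2),
          ENNReal.ofReal ((3 / 2) ^ (n + 1)) * ENNReal.ofReal (1 / (1 + ‖x - y‖) ^ (n + 1)) :=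
          (lintegral_iUnion (fun _ => measurableSet_ball)
            (pairwise_disjoint_ball_latticePoint 0 le_rfl) _).symm
      _ ≤ ∫⁻ y, ENNReal.ofReal ((3 / 2) ^ (n + 1)) *
          ENNReal.ofReal (1 / (1 + ‖x - y‖) ^ (n + 1)) := setLIntegral_le_lintegral _ _
      _ = _ := by
          rw [lintegral_const_mul' _ _ ENNReal.ofReal_ne_top, hI,
            lintegral_sub_left_eq_self (fun y => ENNReal.ofReal (1 / (1 + ‖y‖) ^ (n + 1))) x]
  refine ⟨S.toReal, ENNReal.toReal_nonneg, fun x => ?_⟩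
  have h0 : ∀ m : Fin n → ℤ, 0 ≤ 1 / (1 + ‖x - latticePoint m‖) ^ (n + 1) := fun m => by positivity
  have hsum : Summable (fun m : Fin n → ℤ => 1 / (1 + ‖x - latticePoint m‖) ^ (n + 1)) := by
    have := ENNReal.summable_toReal ((key x).trans_lt hStop.lt_top).ne
    exact this.congr fun m => ENNReal.toReal_ofReal (h0 m)
  refine ⟨hsum, ?_⟩
  rw [← ENNReal.toReal_ofReal (tsum_nonneg h0), ENNReal.ofReal_tsum_of_nonneg h0 hsum]
  exact ENNReal.toReal_mono hStop (key x)

end Lattice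

/-! ### Decay, continuity and total mass of the kernel q₀. -/

section Kernel

variable {n : ℕ}

/-- `φ` decays faster than every negative power of `1 + ‖x‖`. -/
def RapidDecay (φ : Rn n → ℂ) : Prop :=
  ∀ l : ℕ, ∃ C : ℝ, 0 ≤ C ∧ ∀ x, ‖φ x‖ ≤ C * (1 / (1 + ‖x‖) ^ l)

theorem rapidDecay_of_tendsto {φ : Rn n → ℂ} (hc : Continuous φ)
    (h : ∀ l : ℕ, Tendsto (fun x : Rn n => (‖x‖ ^ l : ℝ) • φ x) (Bornology.cobounded (Rn n)) (𝓝 0)) :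
    RapidDecay φ := by
  intro l
  have h1 : ∀ᶠ x in Bornology.cobounded (Rn n), ‖x‖ ^ l * ‖φ x‖ ≤ 1 := by
    have := (h l).norm.eventually_le_const (u := 1) (by rw [norm_zero]; exact one_pos)
    refine this.mono fun x hx => ?_
    simpa [norm_smul] using hx
  have hb : Bornology.IsBounded {x : Rn n | ‖x‖ ^ l * ‖φ x‖ ≤ 1}ᶜ :=
    Bornology.isBounded_def.2 (by rw [compl_compl]; exact h1)
  obtain ⟨R, hR⟩ := hb.subset_closedBall 0
  obtain ⟨M, hM⟩ := (isCompact_closedBall (0 : Rn n) (max R 1)).exists_bound_of_continuousOn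
    hc.continuousOn
  have hM0 : 0 ≤ M := (norm_nonneg _).trans (hM 0 (by simp))
  -- The first term serves the ball of radius max R 1, the second its exterior, where ‖x‖ > 1 gives
  -- 1 + ‖x‖ ≤ 2‖x‖.
  refine ⟨(1 + max R 1) ^ l * M + 2 ^ l, by positivity, fun x => ?_⟩
  rw [mul_one_div, le_div_iff₀ (by positivity)]
  by_cases hx : x ∈ Metric.closedBall (0 : Rn n) (max R 1)
  · have hx' : ‖x‖ ≤ max R 1 := by simpa using hx
    calc ‖φ x‖ * (1 + ‖x‖) ^ l ≤ M * (1 + max R 1) ^ l := by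
          gcongr
          exact hM x hx
      _ ≤ _ := by linarith [pow_pos (zero_lt_two' ℝ) l]
  · have hx' : max R 1 < ‖x‖ := by simpa using hx
    have hx1 : ‖x‖ ^ l * ‖φ x‖ ≤ 1 := by
      by_contra hcon
      have := hR hcon
      rw [mem_closedBall_zero_iff] at this
      exact absurd this (not_le.2 ((le_max_left _ _).trans_lt hx'))
    have h2 : 1 + ‖x‖ ≤ 2 * ‖x‖ := by linarith [le_max_right R 1]
    calc ‖φ x‖ * (1 + ‖x‖) ^ l ≤ ‖φ x‖ * (2 * ‖x‖) ^ l := by gcongr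
      _ = 2 ^ l * (‖x‖ ^ l * ‖φ x‖) := by rw [mul_pow]; ring
      _ ≤ 2 ^ l * 1 := by gcongr
      _ ≤ _ := by
        have : 0 ≤ (1 + max R 1) ^ l * M := by positivity
        linarith

namespace RapidDecay

variable {φ : Rn n → ℂ}

/-- By 1 + |x − y| ≤ (1 + |x − p|)(1 + |y − p|), decay about `p` becomes off-diagonal decay; n + 1
further powers at `x` are reserved for the lattice sum over `p`. -/
theorem exists_norm_mul_le (h : RapidDecay φ) (L : ℕ) : ∃ C : ℝ, 0 ≤ C ∧ ∀ x y p : Rn n,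
    ‖φ (x - p)‖ * ‖φ (y - p)‖ ≤
      C * (1 / (1 + ‖x - y‖) ^ L) * (1 / (1 + ‖x - p‖) ^ (n + 1)) := by
  obtain ⟨C₁, hC₁, h₁⟩ := h (L + (n + 1))
  obtain ⟨C₂, hC₂, h₂⟩ := h L
  refine ⟨C₁ * C₂, by positivity, fun x y p => ?_⟩
  have htri : 1 + ‖x - y‖ ≤ (1 + ‖x - p‖) * (1 + ‖y - p‖) := by
    have : ‖x - y‖ ≤ ‖x - p‖ + ‖y - p‖ := by
      rw [norm_sub_rev y p]; exact norm_sub_le_norm_sub_add_norm_sub _ _ _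
    nlinarith [norm_nonneg (x - p), norm_nonneg (y - p)]
  have hpow : 1 / ((1 + ‖x - p‖) ^ L * (1 + ‖y - p‖) ^ L) ≤ 1 / (1 + ‖x - y‖) ^ L := by
    rw [← mul_pow]
    gcongr
  calc ‖φ (x - p)‖ * ‖φ (y - p)‖
      ≤ (C₁ * (1 / (1 + ‖x - p‖) ^ (L + (n + 1)))) * (C₂ * (1 / (1 + ‖y - p‖) ^ L)) := by
        gcongr
        · exact h₁ _
        · exact h₂ _
    _ = C₁ * C₂ * (1 / ((1 + ‖x - p‖) ^ L * (1 + ‖y - p‖) ^ L)) *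
        (1 / (1 + ‖x - p‖) ^ (n + 1)) := by
        rw [pow_add]; field_simp
    _ ≤ _ := by gcongr

theorem exists_kernelZero_bound (h : RapidDecay φ) (L : ℕ) : ∃ C : ℝ, 0 ≤ C ∧ ∀ x y : Rn n,
    Summable (fun m : Fin n → ℤ => φ (x - latticePoint m) * conj (φ (y - latticePoint m))) ∧
      ‖kernelZero φ x y‖ ≤ C * (1 / (1 + ‖x - y‖) ^ L) := by
  obtain ⟨C, hC, hle⟩ := h.exists_norm_mul_le L
  obtain ⟨S, hS, hsum⟩ := exists_tsum_lattice_le n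
  refine ⟨C * S, by positivity, fun x y => ?_⟩
  have hb : ∀ m : Fin n → ℤ, ‖φ (x - latticePoint m) * conj (φ (y - latticePoint m))‖ ≤
      C * (1 / (1 + ‖x - y‖) ^ L) * (1 / (1 + ‖x - latticePoint m‖) ^ (n + 1)) := fun m => by
    rw [norm_mul, RCLike.norm_conj]
    exact hle _ _ _
  have hs := (hsum x).1.mul_left (C * (1 / (1 + ‖x - y‖) ^ L))
  refine ⟨Summable.of_norm_bounded hs hb, ?_⟩
  refine (tsum_of_norm_bounded hs.hasSum hb).trans ?_
  rw [tsum_mul_left]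
  calc _ ≤ C * (1 / (1 + ‖x - y‖) ^ L) * S := by
        gcongr
        exact (hsum x).2
    _ = _ := by ring

theorem exists_norm_le (h : RapidDecay φ) : ∃ M : ℝ, 0 ≤ M ∧ ∀ x, ‖φ x‖ ≤ M := by
  obtain ⟨C, hC, hle⟩ := h 0
  exact ⟨C, hC, fun x => by simpa using hle x⟩

theorem integrable (h : RapidDecay φ) (hc : Continuous φ) : MeasureTheory.Integrable φ := by
  obtain ⟨C, hC, hle⟩ := h (n + 1)
  exact (integrable_one_div_one_add_norm_pow.const_mul C).mono' hc.aestronglyMeasurable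
    (Eventually.of_forall hle)

theorem summable_norm_translates (h : RapidDecay φ) (x : Rn n) :
    Summable fun m : Fin n → ℤ => ‖φ (x - latticePoint m)‖ := by
  obtain ⟨C, hC, hle⟩ := h (n + 1)
  obtain ⟨S, hS, hsum⟩ := exists_tsum_lattice_le n
  exact Summable.of_nonneg_of_le (fun _ => norm_nonneg _) (fun m => hle _)
    ((hsum x).1.mul_left C)

theorem continuous_kernelZero (h : RapidDecay φ) (hc : Continuous φ) (x : Rn n) :
    Continuous (kernelZero φ x) := by
  obtain ⟨M, hM, hle⟩ := h.exists_norm_le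
  refine continuous_tsum (u := fun m => ‖φ (x - latticePoint m)‖ * M) (fun m => by fun_prop)
    ((h.summable_norm_translates x).mul_right M) fun m y => ?_
  rw [norm_mul, RCLike.norm_conj]
  gcongr
  exact hle _

theorem integrable_kernelZero (h : RapidDecay φ) (hc : Continuous φ) (x : Rn n) :
    MeasureTheory.Integrable (kernelZero φ x) := by
  obtain ⟨C, hC, hle⟩ := h.exists_kernelZero_bound (n + 1)
  exact ((integrable_one_div_one_add_norm_pow.comp_sub_left x).const_mul C).mono'
    (h.continuous_kernelZero hc x).aestronglyMeasurable (Eventually.of_forall fun y => (hle x y).2)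

/-- Termwise integration, valid at every `x`. It serves g = 1, for the mass of the kernel, and
indicators, for the projection onto V₀. -/
theorem hasSum_integral_kernelZero (h : RapidDecay φ) (hc : Continuous φ) (x : Rn n)
    {g : Rn n → ℂ} (hg : AEStronglyMeasurable g) (hg1 : ∀ y, ‖g y‖ ≤ 1) :
    HasSum (fun m : Fin n → ℤ => φ (x - latticePoint m) *
      ∫ y, conj (φ (y - latticePoint m)) * g y) (∫ y, kernelZero φ x y * g y) := by
  have hi : ∀ m : Fin n → ℤ,
      MeasureTheory.Integrable fun y => conj (φ (y - latticePoint m)) * g y := fun m => by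
    refine ((h.integrable hc).comp_sub_right (latticePoint m)).norm.mono'
      ((by fun_prop : Continuous fun y => conj (φ (y - latticePoint m))).aestronglyMeasurable.mul hg)
      (Eventually.of_forall fun y => ?_)
    rw [norm_mul, RCLike.norm_conj]
    exact mul_le_of_le_one_right (norm_nonneg _) (hg1 y)
  have hn : ∀ m : Fin n → ℤ, ∫ y, ‖φ (x - latticePoint m) * (conj (φ (y - latticePoint m)) * g y)‖ ≤
      ‖φ (x - latticePoint m)‖ * ∫ y, ‖φ y‖ := fun m => by
    rw [← integral_sub_right_eq_self (fun y => ‖φ y‖) (latticePoint m), ← integral_const_mul]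
    refine integral_mono ((hi m).const_mul _).norm
      (((h.integrable hc).comp_sub_right (latticePoint m)).norm.const_mul _) fun y => ?_
    simp only [norm_mul, RCLike.norm_conj]
    gcongr
    exact mul_le_of_le_one_right (norm_nonneg _) (hg1 y)
  have := hasSum_integral_of_summable_integral_norm
    (F := fun (m : Fin n → ℤ) y => φ (x - latticePoint m) * (conj (φ (y - latticePoint m)) * g y))
    (fun m => (hi m).const_mul _)
    (Summable.of_nonneg_of_le (fun m => integral_nonneg fun _ => norm_nonneg _) hn
      ((h.summable_norm_translates x).mul_right _))
  simp only [integral_const_mul] at this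
  have hk : ∀ y, kernelZero φ x y * g y = ∑' m : Fin n → ℤ,
      φ (x - latticePoint m) * (conj (φ (y - latticePoint m)) * g y) := fun y => by
    rw [kernelZero, ← tsum_mul_right]
    simp only [mul_assoc]
  simpa only [hk] using this

theorem integral_kernelZero_eq (h : RapidDecay φ) (hc : Continuous φ) (x : Rn n) :
    ∫ y, kernelZero φ x y = ∑' m : Fin n → ℤ, φ (x - latticePoint m) * ∫ y, conj (φ y) := by
  have := h.hasSum_integral_kernelZero hc x (g := fun _ => 1) aestronglyMeasurable_const (by simp)
  simp only [mul_one] at this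
  rw [← this.tsum_eq]
  congr 1
  ext m
  rw [integral_sub_right_eq_self (fun y => conj (φ y))]

theorem integral_kernelZero_add_latticePoint (h : RapidDecay φ) (hc : Continuous φ) (x : Rn n)
    (p : Fin n → ℤ) :
    ∫ y, kernelZero φ (x + latticePoint p) y = ∫ y, kernelZero φ x y := by
  rw [h.integral_kernelZero_eq hc, h.integral_kernelZero_eq hc,
    ← (Equiv.addRight p).tsum_eq (fun m => φ (x + latticePoint p - latticePoint m) * _)]
  congr 1
  ext m
  have : x + latticePoint p - latticePoint (m + p) = x - latticePoint m := by
    have : latticePoint (m + p) = latticePoint m + (latticePoint p : Rn n) := by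
      ext i; simp [latticePoint]
    rw [this]; abel
  rw [Equiv.coe_addRight, this]

theorem continuous_integral_kernelZero (h : RapidDecay φ) (hc : Continuous φ) :
    Continuous fun x => ∫ y, kernelZero φ x y := by
  simp only [h.integral_kernelZero_eq hc, tsum_mul_right]
  refine Continuous.mul ?_ continuous_const
  obtain ⟨C, hC, hle⟩ := h (n + 1)
  obtain ⟨S, hS, hsum⟩ := exists_tsum_lattice_le n
  refine continuous_iff_continuousAt.2 fun x₀ => ?_
  -- For |x − x₀| < 1 one has 1 + |x₀ − m| ≤ 2(1 + |x − m|), whence the factor 2^(n+1) in a majorant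
  -- independent of `x`.
  refine tendsto_tsum_of_dominated_convergence
    (bound := fun m => C * 2 ^ (n + 1) * (1 / (1 + ‖x₀ - latticePoint m‖) ^ (n + 1)))
    ((hsum x₀).1.mul_left _)
    (fun m => (by fun_prop : Continuous fun x => φ (x - latticePoint m)).continuousAt) ?_
  filter_upwards [Metric.ball_mem_nhds x₀ one_pos] with x hx m
  refine (hle _).trans ?_
  rw [mul_assoc]
  gcongr
  rw [mem_ball_iff_norm'] at hx
  have h1 : ‖x₀ - latticePoint m‖ ≤ ‖x₀ - x‖ + ‖x - latticePoint m‖ :=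
    norm_sub_le_norm_sub_add_norm_sub _ _ _
  have h2 : 1 + ‖x₀ - latticePoint m‖ ≤ 2 * (1 + ‖x - latticePoint m‖) := by
    linarith [norm_nonneg (x - latticePoint m)]
  rw [mul_one_div, div_le_div_iff₀ (by positivity) (by positivity), one_mul, ← mul_pow]
  exact pow_le_pow_left₀ (by positivity) h2 _

/-- Of n + 2 powers of decay, n + 1 ensure integrability and the last one yields 1 / (1 + r). -/
theorem exists_setIntegral_kernelZero_le (h : RapidDecay φ) (hc : Continuous φ) :
    ∃ T : ℝ, 0 ≤ T ∧ ∀ (x : Rn n) (r : ℝ), 0 ≤ r → ∀ s : Set (Rn n), MeasurableSet s →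
      (∀ y ∈ s, r ≤ ‖x - y‖) → ∫ y in s, ‖kernelZero φ x y‖ ≤ T / (1 + r) := by
  obtain ⟨C, hC, hle⟩ := h.exists_kernelZero_bound (n + 2)
  refine ⟨C * ∫ y : Rn n, 1 / (1 + ‖y‖) ^ (n + 1), ?_, fun x r hr s hs hsr => ?_⟩
  · exact mul_nonneg hC (integral_nonneg fun y => by positivity)
  have hi := (integrable_one_div_one_add_norm_pow (n := n)).comp_sub_left x
  have hI := integral_sub_left_eq_self (fun y : Rn n => 1 / (1 + ‖y‖) ^ (n + 1)) volume x
  calc ∫ y in s, ‖kernelZero φ x y‖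
      ≤ ∫ y in s, C / (1 + r) * (1 / (1 + ‖x - y‖) ^ (n + 1)) := by
        refine setIntegral_mono_on (h.integrable_kernelZero hc x).norm.integrableOn
          (hi.const_mul _).integrableOn hs fun y hy => ?_
        refine (hle x y).2.trans ?_
        rw [pow_succ _ (n + 1), ← one_div_mul_one_div]
        have : 1 / (1 + ‖x - y‖) ≤ 1 / (1 + r) := by
          have := hsr y hy
          gcongr
        calc C * (1 / (1 + ‖x - y‖) ^ (n + 1) * (1 / (1 + ‖x - y‖)))
            ≤ C * (1 / (1 + ‖x - y‖) ^ (n + 1) * (1 / (1 + r))) := by gcongr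
          _ = _ := by ring
    _ ≤ ∫ y, C / (1 + r) * (1 / (1 + ‖x - y‖) ^ (n + 1)) :=
        setIntegral_le_integral (hi.const_mul _) (Eventually.of_forall fun y => by
          simp only [Pi.zero_apply]; positivity)
    _ = _ := by
        rw [integral_const_mul, hI]
        ring

end RapidDecay

end Kernel

/-! ### The projection onto V₀, and kernel mass one. -/

section Reproducing

variable {n : ℕ}

theorem L2_norm_sq_eq_integral (u : L2 n) : ‖u‖ ^ 2 = ∫ x, ‖(u : Rn n → ℂ) x‖ ^ 2 := by
  have h : (inner ℂ u u : ℂ) = ((‖u‖ ^ 2 : ℝ) : ℂ) := by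
    rw [inner_self_eq_norm_sq_to_K]; push_cast; rfl
  rw [L2.inner_def] at h
  have h2 : (∫ x, inner ℂ ((u : Rn n → ℂ) x) ((u : Rn n → ℂ) x)) =
      ((∫ x, ‖(u : Rn n → ℂ) x‖ ^ 2 : ℝ) : ℂ) := by
    rw [← integral_complex_ofReal]
    refine integral_congr_ae (Eventually.of_forall fun x => ?_)
    simp only
    rw [inner_self_eq_norm_sq_to_K]; push_cast; rfl
  rw [h2] at h
  exact_mod_cast h.symm

theorem L2_integrable_norm_sq (u : L2 n) :
    MeasureTheory.Integrable fun x => ‖(u : Rn n → ℂ) x‖ ^ 2 :=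
  (Lp.memLp u).integrable_norm_pow two_ne_zero

theorem quasiMeasurePreserving_smul {r : ℝ} (hr : r ≠ 0) :
    Measure.QuasiMeasurePreserving (fun x : Rn n => r • x) volume volume :=
  ⟨measurable_const_smul r, by
    rw [Measure.map_addHaar_smul _ hr]
    exact Measure.smul_absolutelyContinuous⟩

theorem memLp_comp_smul (u : L2 n) {r : ℝ} (hr : r ≠ 0) :
    MemLp (fun x => (u : Rn n → ℂ) (r • x)) 2 volume := by
  have h : MemLp (u : Rn n → ℂ) 2 (Measure.map (fun x : Rn n => r • x) volume) := by
    rw [Measure.map_addHaar_smul _ hr]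
    exact (Lp.memLp u).smul_measure ENNReal.ofReal_ne_top
  exact (memLp_map_measure_iff h.1 (measurable_const_smul r).aemeasurable).1 h

theorem norm_sq_eq_of_ae_eq_comp_smul {u v : L2 n} {r : ℝ} (hr : 0 < r)
    (h : (v : Rn n → ℂ) =ᵐ[volume] fun x => (u : Rn n → ℂ) (r • x)) :
    ‖v‖ ^ 2 = (r ^ n)⁻¹ * ‖u‖ ^ 2 := by
  have h' : (fun x => ‖(v : Rn n → ℂ) x‖ ^ 2) =ᵐ[volume] fun x => ‖(u : Rn n → ℂ) (r • x)‖ ^ 2 :=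
    h.mono fun x hx => by simp only [hx]
  rw [L2_norm_sq_eq_integral, L2_norm_sq_eq_integral, integral_congr_ae h',
    Measure.integral_comp_smul volume (fun x => ‖(u : Rn n → ℂ) x‖ ^ 2),
    finrank_euclideanSpace_fin, abs_of_pos (by positivity), smul_eq_mul]

/-- Rescaling an element of `V_j` to `V_0`. -/
theorem IsMRA.exists_mem_zero {V : ℤ → Submodule ℂ (L2 n)} (hV : IsMRA V) (j : ℕ) :
    ∀ g ∈ V j, ∃ h ∈ V 0,
      (h : Rn n → ℂ) =ᵐ[volume] fun x => (g : Rn n → ℂ) (((2 : ℝ) ^ j)⁻¹ • x) := by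
  induction j with
  | zero => exact fun g hg => ⟨g, hg, by simp⟩
  | succ j ih =>
    intro g hg
    have h2 : (2 : ℝ)⁻¹ ≠ 0 := by norm_num
    let f : L2 n := (memLp_comp_smul g h2).toLp _
    have hf : (f : Rn n → ℂ) =ᵐ[volume] fun x => (g : Rn n → ℂ) ((2 : ℝ)⁻¹ • x) :=
      MemLp.coeFn_toLp _
    have hfV : f ∈ V j := by
      refine (hV.dilation j f g ?_).2 (by exact_mod_cast hg)
      filter_upwards [(quasiMeasurePreserving_smul (two_ne_zero (α := ℝ))).ae_eq_comp hf] with x hx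
      simp only [Function.comp] at hx
      rw [hx, smul_smul]
      norm_num
    obtain ⟨h, hh, hhf⟩ := ih f hfV
    refine ⟨h, hh, hhf.trans ?_⟩
    have hne : ((2 : ℝ) ^ j)⁻¹ ≠ 0 := by positivity
    filter_upwards [(quasiMeasurePreserving_smul hne).ae_eq_comp hf] with x hx
    simp only [Function.comp] at hx
    rw [hx, smul_smul, pow_succ, mul_inv, mul_comm]

/-- `q₀` is the integral kernel of the orthogonal projection onto `V₀`. -/
theorem IsScalingFunction.starProjection_ae_eq {V : ℤ → Submodule ℂ (L2 n)} {φ : Rn n → ℂ}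
    (hφ : IsScalingFunction V φ) (hd : RapidDecay φ) (hc : Continuous φ)
    [(V 0).HasOrthogonalProjection] {f : L2 n} {g : Rn n → ℂ}
    (hfg : (f : Rn n → ℂ) =ᵐ[volume] g) (hg1 : ∀ y, ‖g y‖ ≤ 1) :
    ((V 0).starProjection f : Rn n → ℂ) =ᵐ[volume] fun x => ∫ y, kernelZero φ x y * g y := by
  obtain ⟨b, hb⟩ := hφ
  have hg : AEStronglyMeasurable g := (Lp.aestronglyMeasurable f).congr hfg
  let c : (Fin n → ℤ) → ℂ := fun m => ∫ y, conj (φ (y - latticePoint m)) * g y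
  let P : V 0 := (V 0).orthogonalProjectionOnto f
  have hcoef : ∀ m, b.repr P m = c m := by
    intro m
    rw [b.repr_apply_apply, Submodule.inner_orthogonalProjectionOnto_eq_of_mem_left, L2.inner_def]
    refine integral_congr_ae ?_
    filter_upwards [hb m, hfg] with x h1 h2
    rw [h1, h2, RCLike.inner_apply']
  have hsum : HasSum (fun m => c m • (b m : L2 n)) ((V 0).starProjection f) := by
    have h : HasSum (fun m => c m • (b m : L2 n)) (P : L2 n) := by
      simpa [hcoef] using (b.hasSum_repr P).mapL (V 0).subtypeL
    exact h
  -- The basis expansion converges in L², hence almost everywhere along some finite sets `ns i`; the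
  -- pointwise sum over the lattice identifies the limit.
  obtain ⟨ns, hns, hae⟩ := (tendstoInMeasure_of_tendsto_Lp hsum).exists_seq_tendsto_ae'
  have hpart : ∀ᵐ x, ∀ i, ((∑ m ∈ ns i, c m • (b m : L2 n) : L2 n) : Rn n → ℂ) x =
      ∑ m ∈ ns i, φ (x - latticePoint m) * c m := by
    refine ae_all_iff.2 fun i => ?_
    have hb' : ∀ᵐ x, ∀ m, ((c m • (b m : L2 n) : L2 n) : Rn n → ℂ) x =
        φ (x - latticePoint m) * c m := by
      refine ae_all_iff.2 fun m => ?_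
      filter_upwards [hb m, Lp.coeFn_smul (c m) (b m : L2 n)] with x h1 h2
      rw [h2, Pi.smul_apply, h1, smul_eq_mul, mul_comm]
    filter_upwards [hb', Lp.coeFn_fun_finsetSum (ns i) fun m => c m • (b m : L2 n)] with x h1 h2
    rw [h2]
    exact Finset.sum_congr rfl fun m _ => h1 m
  filter_upwards [hae, hpart] with x h1 h2
  simp only [h2] at h1
  exact tendsto_nhds_unique h1 ((hd.hasSum_integral_kernelZero hc x hg hg1).comp hns)

theorem norm_latticePoint_le {N : ℕ} (m : Fin n → Fin N) :
    ‖latticePoint fun i => ((m i : ℕ) : ℤ)‖ ≤ n * N := by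
  refine abs_le_of_sq_le_sq' ?_ (by positivity) |>.2
  rw [EuclideanSpace.norm_sq_eq]
  have h : ∀ i : Fin n, ‖(latticePoint fun i => ((m i : ℕ) : ℤ) : Rn n) i‖ ^ 2 ≤ (N : ℝ) ^ 2 := by
    intro i
    have : ((m i : ℕ) : ℝ) ≤ N := by exact_mod_cast (m i).2.le
    simp only [latticePoint, Int.cast_natCast, RCLike.norm_natCast]
    gcongr
  refine (Finset.sum_le_sum fun i _ => h i).trans ?_
  rw [Finset.sum_const, Finset.card_univ, Fintype.card_fin, nsmul_eq_mul, mul_pow]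
  gcongr
  exact_mod_cast Nat.le_self_pow two_ne_zero n

/-- The reproducing kernel of a multiresolution analysis reproduces constants. -/
theorem IsMRA.integral_kernelZero_eq_one {V : ℤ → Submodule ℂ (L2 n)} (hV : IsMRA V)
    {φ : Rn n → ℂ} (hφ : IsScalingFunction V φ) (hd : RapidDecay φ) (hc : Continuous φ) (x : Rn n) :
    ∫ y, kernelZero φ x y = 1 := by
  have : CompleteSpace (V 0) := (hV.isClosed 0).completeSpace_coe
  set Φ : Rn n → ℂ := fun x => ∫ y, kernelZero φ x y with hΦ
  have hΦc : Continuous Φ := hd.continuous_integral_kernelZero hc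
  change Φ x = 1
  by_contra hne
  set η := ‖1 - Φ x‖ / 2 with hη
  have hη0 : 0 < η := half_pos (norm_pos_iff.2 (sub_ne_zero.2 (Ne.symm hne)))
  -- The bound ρ ≤ 1/2 makes the lattice translates of the ball disjoint.
  obtain ⟨ρ, hρ0, hρ1, hρ⟩ : ∃ ρ : ℝ, 0 < ρ ∧ ρ ≤ 1 / 2 ∧
      ∀ y ∈ Metric.ball x ρ, η ≤ ‖1 - Φ y‖ := by
    have hlt : η < ‖1 - Φ x‖ := by linarith
    have := ((continuous_const.sub hΦc).norm.tendsto x).eventually (lt_mem_nhds hlt)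
    obtain ⟨ρ, hρ, h⟩ := Metric.mem_nhds_iff.1 this
    exact ⟨min ρ (1 / 2), lt_min hρ (by norm_num), min_le_right _ _, fun y hy =>
      (h (Metric.ball_subset_ball (min_le_left _ _) hy)).le⟩
  -- Chosen so that the translates by {0, …, 2^j − 1}ⁿ lie in the ball of radius C · 2^j; radius (C
  -- + 1) · 2^j then leaves a collar of width 2^j.
  set C : ℝ := ‖x‖ + 1 / 2 + n with hC
  have hC0 : 0 ≤ C := by positivity
  set w := volume.real (Metric.ball (0 : Rn n) ρ) with hw
  have hw0 : 0 < w :=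
    ENNReal.toReal_pos (Metric.measure_ball_pos _ _ hρ0).ne' measure_ball_lt_top.ne
  let f₁ : L2 n := indicatorConstLp 2 (s := Metric.ball (0 : Rn n) (C + 1)) measurableSet_ball
    measure_ball_lt_top.ne (1 : ℂ)
  -- After dilation by 2^j, this tolerance is exactly what the lower bound `hge` contradicts.
  obtain ⟨g, hg, hgδ⟩ := hV.dense_iUnion.exists_dist_lt f₁
    (ε := √(w * (η / 2) ^ 2)) (by positivity)
  obtain ⟨j₀, hg⟩ := mem_iUnion.1 hg
  obtain ⟨T, hT0, hT⟩ := hd.exists_setIntegral_kernelZero_le hc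
  obtain ⟨j, hj₀, hjT⟩ : ∃ j : ℕ, j₀ ≤ j ∧ T / (1 + 2 ^ j) ≤ η / 2 := by
    have h1 : Tendsto (fun j : ℕ => T / (1 + (2 : ℝ) ^ j)) atTop (𝓝 0) :=
      (tendsto_atTop_add_const_left _ _
        (tendsto_pow_atTop_atTop_of_one_lt one_lt_two)).const_div_atTop _
    obtain ⟨j, hj1, hj2⟩ := ((h1.eventually (ge_mem_nhds (half_pos hη0))).and
      (eventually_ge_atTop j₀.toNat)).exists
    exact ⟨j, by omega, hj1⟩
  set N : ℝ := 2 ^ j with hN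
  have hN0 : 0 < N := by positivity
  have hN1 : 1 ≤ N := one_le_pow₀ one_le_two
  let f : L2 n := indicatorConstLp 2 (s := Metric.ball (0 : Rn n) ((C + 1) * N)) measurableSet_ball
    measure_ball_lt_top.ne (1 : ℂ)
  obtain ⟨h, hh, hhg⟩ := hV.exists_mem_zero j g (hV.monotone hj₀ hg)
  have hnorm : ‖f - h‖ ^ 2 = N ^ n * ‖f₁ - g‖ ^ 2 := by
    rw [norm_sq_eq_of_ae_eq_comp_smul (u := f₁ - g) (r := N⁻¹) (by positivity), inv_pow, inv_inv]
    have hq := quasiMeasurePreserving_smul (n := n) (inv_ne_zero hN0.ne')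
    filter_upwards [Lp.coeFn_sub f h, hq.ae (Lp.coeFn_sub f₁ g), hhg,
      (indicatorConstLp_coeFn : (f : Rn n → ℂ) =ᵐ[volume] _),
      hq.ae (indicatorConstLp_coeFn : (f₁ : Rn n → ℂ) =ᵐ[volume] _)] with y h1 h2 h3 h4 h5
    rw [h1, h2, Pi.sub_apply, Pi.sub_apply, h3, h4, h5]
    congr 1
    have hiff : N⁻¹ • y ∈ Metric.ball (0 : Rn n) (C + 1) ↔
        y ∈ Metric.ball (0 : Rn n) ((C + 1) * N) := by
      rw [mem_ball_zero_iff, mem_ball_zero_iff, norm_smul, norm_inv, Real.norm_of_nonneg hN0.le,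
        inv_mul_lt_iff₀ hN0, mul_comm N]
    by_cases hy : y ∈ Metric.ball (0 : Rn n) ((C + 1) * N)
    · rw [indicator_of_mem hy, indicator_of_mem (hiff.2 hy)]
    · rw [indicator_of_notMem hy, indicator_of_notMem (fun h => hy (hiff.1 h))]
  set D : L2 n := f - (V 0).starProjection f with hD
  have hDle : ‖D‖ ≤ ‖f - h‖ := by
    rw [hD, Submodule.starProjection_minimal]
    exact ciInf_le ⟨0, by rintro _ ⟨z, rfl⟩; exact norm_nonneg _⟩ (⟨h, hh⟩ : V 0)
  have hDlt : ‖D‖ ^ 2 < N ^ n * (w * (η / 2) ^ 2) := by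
    have : ‖f₁ - g‖ ^ 2 < w * (η / 2) ^ 2 := by
      rw [← dist_eq_norm]
      exact (Real.lt_sqrt dist_nonneg).1 hgδ
    calc ‖D‖ ^ 2 ≤ ‖f - h‖ ^ 2 := by gcongr
      _ = N ^ n * ‖f₁ - g‖ ^ 2 := hnorm
      _ < _ := by gcongr
  let U : Set (Rn n) := ⋃ m : Fin n → Fin (2 ^ j),
    Metric.ball (x + latticePoint fun i => ((m i : ℕ) : ℤ)) ρ
  have hUm : MeasurableSet U := MeasurableSet.iUnion fun _ => measurableSet_ball
  have hUsub : U ⊆ Metric.ball 0 (C * N) := by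
    refine iUnion_subset fun m y hy => ?_
    rw [mem_ball_iff_norm] at hy
    rw [mem_ball_zero_iff]
    have h1 := norm_latticePoint_le m
    push_cast at h1
    rw [← hN] at h1
    have h2 : ‖y‖ ≤ ‖y - (x + latticePoint fun i => ((m i : ℕ) : ℤ))‖ +
        (‖x‖ + ‖latticePoint fun i => ((m i : ℕ) : ℤ)‖) := by
      refine (norm_le_norm_sub_add y (x + latticePoint fun i => ((m i : ℕ) : ℤ))).trans ?_
      gcongr
      exact norm_add_le _ _
    have h3 : ‖x‖ + 1 / 2 ≤ (‖x‖ + 1 / 2) * N :=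
      le_mul_of_one_le_right (by positivity) hN1
    calc ‖y‖ < 1 / 2 + (‖x‖ + n * N) := by linarith
      _ ≤ C * N := by rw [hC]; linarith
  have hUvol : volume.real U = N ^ n * w := by
    have hdisj : Pairwise (Function.onFun Disjoint fun m : Fin n → Fin (2 ^ j) =>
        Metric.ball (x + latticePoint fun i => ((m i : ℕ) : ℤ)) ρ) := fun m k hmk =>
      pairwise_disjoint_ball_latticePoint x hρ1 fun hcon => hmk (funext fun i => by
        have := congrFun hcon i
        exact Fin.ext (by exact_mod_cast this))
    rw [Measure.real, measure_iUnion hdisj fun _ => measurableSet_ball, tsum_fintype]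
    simp only [Measure.addHaar_ball_center]
    rw [Finset.sum_const, Finset.card_univ, Fintype.card_fun, Fintype.card_fin, Fintype.card_fin,
      nsmul_eq_mul, ENNReal.toReal_mul, ENNReal.toReal_natCast, hw, Measure.real]
    push_cast
    rfl
  have hindle : ∀ y, ‖(Metric.ball (0 : Rn n) ((C + 1) * N)).indicator (fun _ => (1 : ℂ)) y‖ ≤ 1 :=
    fun y => (norm_indicator_le_norm_self _ _).trans (by simp)
  have hproj := hφ.starProjection_ae_eq hd hc (f := f) indicatorConstLp_coeFn hindle
  -- On `U`, periodicity gives |1 − Φ| ≥ η, and truncating the kernel to the large ball costs at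
  -- most η / 2, since points outside it are at distance at least `N` from `y`.
  have hlow : ∀ᵐ y, y ∈ U → (η / 2) ^ 2 ≤ ‖(D : Rn n → ℂ) y‖ ^ 2 := by
    filter_upwards [hproj, Lp.coeFn_sub f ((V 0).starProjection f),
      (indicatorConstLp_coeFn : (f : Rn n → ℂ) =ᵐ[volume] _)] with y h1 h2 h3 hy
    have hyC : y ∈ Metric.ball (0 : Rn n) (C * N) := hUsub hy
    have hyC1 : y ∈ Metric.ball (0 : Rn n) ((C + 1) * N) :=
      Metric.ball_subset_ball (by nlinarith) hyC
    have hDy : (D : Rn n → ℂ) y = 1 - ∫ z, kernelZero φ y z *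
        (Metric.ball (0 : Rn n) ((C + 1) * N)).indicator (fun _ => (1 : ℂ)) z := by
      rw [hD, h2, Pi.sub_apply, h1, h3, indicator_of_mem hyC1]
    have hηy : η ≤ ‖1 - Φ y‖ := by
      obtain ⟨m, hm⟩ := mem_iUnion.1 hy
      have h4 := hρ (y - latticePoint fun i => ((m i : ℕ) : ℤ)) (by
        rw [mem_ball_iff_norm] at hm ⊢
        rwa [sub_sub, add_comm (latticePoint _) x])
      have h5 := hd.integral_kernelZero_add_latticePoint hc
        (y - latticePoint fun i => ((m i : ℕ) : ℤ)) fun i => ((m i : ℕ) : ℤ)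
      rw [sub_add_cancel] at h5
      simp only [hΦ] at h4 ⊢
      rwa [h5]
    have hdiff : ‖Φ y - ∫ z, kernelZero φ y z *
        (Metric.ball (0 : Rn n) ((C + 1) * N)).indicator (fun _ => (1 : ℂ)) z‖ ≤ η / 2 := by
      have hi := hd.integrable_kernelZero hc y
      have e : ∫ z, kernelZero φ y z *
          (Metric.ball (0 : Rn n) ((C + 1) * N)).indicator (fun _ => (1 : ℂ)) z =
          ∫ z in Metric.ball (0 : Rn n) ((C + 1) * N), kernelZero φ y z := by
        rw [← integral_indicator measurableSet_ball]
        congr 1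
        ext z
        by_cases hz : z ∈ Metric.ball (0 : Rn n) ((C + 1) * N)
        · rw [indicator_of_mem hz, indicator_of_mem hz, mul_one]
        · rw [indicator_of_notMem hz, indicator_of_notMem hz, mul_zero]
      have e2 : Φ y - ∫ z in Metric.ball (0 : Rn n) ((C + 1) * N), kernelZero φ y z =
          ∫ z in (Metric.ball (0 : Rn n) ((C + 1) * N))ᶜ, kernelZero φ y z := by
        simp only [hΦ]
        rw [← integral_add_compl (measurableSet_ball (x := (0 : Rn n))
          (ε := (C + 1) * N)) hi]
        ring
      rw [e, e2]
      refine (norm_integral_le_integral_norm _).trans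
        ((hT y N hN0.le _ measurableSet_ball.compl fun z hz => ?_).trans hjT)
      rw [mem_compl_iff, mem_ball_zero_iff, not_lt] at hz
      rw [mem_ball_zero_iff] at hyC
      have := norm_sub_norm_le z y
      rw [norm_sub_rev] at this
      linarith
    gcongr
    rw [hDy]
    have h6 := norm_sub_le_norm_sub_add_norm_sub 1 (∫ z, kernelZero φ y z *
        (Metric.ball (0 : Rn n) ((C + 1) * N)).indicator (fun _ => (1 : ℂ)) z) (Φ y)
    rw [norm_sub_rev] at hdiff
    linarith
  have hUfin : volume U ≠ ∞ := ((measure_mono hUsub).trans_lt measure_ball_lt_top).ne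
  have hge : N ^ n * w * (η / 2) ^ 2 ≤ ‖D‖ ^ 2 := by
    rw [L2_norm_sq_eq_integral, ← hUvol, ← smul_eq_mul, ← setIntegral_const]
    refine (setIntegral_mono_on_ae (integrableOn_const hUfin)
      (L2_integrable_norm_sq D).integrableOn hUm hlow).trans ?_
    exact setIntegral_le_integral (L2_integrable_norm_sq D)
      (Eventually.of_forall fun y => by simp only [Pi.zero_apply]; positivity)
  linarith

end Reproducing

/-! ### Convergence of the expansions. -/

section Expansion

variable {n : ℕ} {φ : Rn n → ℂ}

theorem RapidDecay.exists_kernel_bound (h : RapidDecay φ) (L : ℕ) : ∃ C : ℝ, 0 ≤ C ∧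
    ∀ (j : ℤ) (x y : Rn n), ‖kernel φ j x y‖ ≤
      C * ((2 : ℝ) ^ ((n : ℤ) * j) * (1 / (1 + 2 ^ j * ‖x - y‖) ^ L)) := by
  obtain ⟨C, hC, hle⟩ := h.exists_kernelZero_bound L
  refine ⟨C, hC, fun j x y => ?_⟩
  have := (hle ((2 : ℝ) ^ j • x) ((2 : ℝ) ^ j • y)).2
  rw [← smul_sub, norm_smul, Real.norm_of_nonneg (by positivity)] at this
  rw [kernel, norm_mul, norm_zpow, Complex.norm_ofNat]
  calc _ ≤ (2 : ℝ) ^ ((n : ℤ) * j) * (C * (1 / (1 + 2 ^ j * ‖x - y‖) ^ L)) := by gcongr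
    _ = _ := by ring

theorem RapidDecay.continuous_kernel (h : RapidDecay φ) (hc : Continuous φ) (j : ℤ) (x : Rn n) :
    Continuous (kernel φ j x) :=
  continuous_const.mul ((h.continuous_kernelZero hc _).comp (continuous_const_smul _))

theorem RapidDecay.integrable_kernel (h : RapidDecay φ) (hc : Continuous φ) (j : ℤ) (x : Rn n) :
    MeasureTheory.Integrable (kernel φ j x) :=
  ((h.integrable_kernelZero hc _).comp_smul (by positivity)).const_mul _

theorem integral_kernel (φ : Rn n → ℂ) (j : ℤ) (x : Rn n) :
    ∫ y, kernel φ j x y = ∫ y, kernelZero φ ((2 : ℝ) ^ j • x) y := by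
  simp only [kernel]
  rw [integral_const_mul, Measure.integral_comp_smul volume (kernelZero φ ((2 : ℝ) ^ j • x)),
    finrank_euclideanSpace_fin, abs_of_pos (by positivity), Complex.real_smul, ← mul_assoc]
  push_cast
  rw [← zpow_natCast, ← zpow_mul, mul_comm j, mul_inv_cancel₀ (zpow_ne_zero _ two_ne_zero), one_mul]

namespace ComplexRadonMeasure

variable {μ : ComplexRadonMeasure n}

theorem IsTempered.integrable_of_norm_le (hμ : μ.IsTempered) {g : Rn n → ℂ} (hg : Continuous g)
    (hle : ∀ L : ℕ, ∃ C : ℝ, ∀ y, ‖g y‖ ≤ C * (1 / (1 + ‖y‖) ^ L)) : μ.Integrable g := by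
  obtain ⟨k, hk, hfin⟩ := hμ
  obtain ⟨C, hC⟩ := hle ⌈k⌉₊
  have hcont : Continuous fun x : Rn n => 1 / (1 + ‖x‖) ^ k := by
    refine continuous_const.div ((continuous_const.add continuous_norm).rpow_const
      fun x => Or.inr hk) fun x => ?_
    positivity
  have hi : MeasureTheory.Integrable (fun x : Rn n => 1 / (1 + ‖x‖) ^ k) μ.variation := by
    refine ⟨hcont.aestronglyMeasurable, ?_⟩
    rw [hasFiniteIntegral_iff_ofReal (Eventually.of_forall fun x => by
      simp only [Pi.zero_apply]; positivity)]
    exact hfin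
  refine (hi.const_mul |C|).mono' hg.aestronglyMeasurable (Eventually.of_forall fun y => ?_)
  refine (hC y).trans ?_
  have h1 : (1 + ‖y‖) ^ k ≤ (1 + ‖y‖) ^ ⌈k⌉₊ := by
    rw [← Real.rpow_natCast]
    exact Real.rpow_le_rpow_of_exponent_le (by linarith [norm_nonneg y]) (Nat.le_ceil k)
  gcongr
  exact le_abs_self C

/-- Chebyshev's argument: on the ball 1 + |y| ≤ (1 + |x₀|)(1 + r), so its indicator is at most a
multiple of the tempered weight. -/
theorem IsTempered.exists_variation_ball_le (hμ : μ.IsTempered) (x₀ : Rn n) :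
    ∃ (A : ℝ) (K : ℕ), 0 ≤ A ∧ ∀ r : ℝ, 0 < r →
      μ.variation (Metric.ball x₀ r) ≤ ENNReal.ofReal (A * (1 + r) ^ K) := by
  obtain ⟨k, hk, hfin⟩ := hμ
  set I := ∫⁻ x, ENNReal.ofReal (1 / (1 + ‖x‖) ^ k) ∂μ.variation with hI
  refine ⟨(1 + ‖x₀‖) ^ ⌈k⌉₊ * I.toReal, ⌈k⌉₊, by positivity, fun r hr => ?_⟩
  have hrw : (1 + ‖x₀‖) ^ ⌈k⌉₊ * I.toReal * (1 + r) ^ ⌈k⌉₊ =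
      ((1 + ‖x₀‖) * (1 + r)) ^ ⌈k⌉₊ * I.toReal := by rw [mul_pow]; ring
  rw [hrw, ENNReal.ofReal_mul (by positivity), ENNReal.ofReal_toReal hfin.ne, hI,
    ← lintegral_const_mul' _ _ ENNReal.ofReal_ne_top]
  calc μ.variation (Metric.ball x₀ r) = ∫⁻ _ in Metric.ball x₀ r, 1 ∂μ.variation := by simp
    _ ≤ ∫⁻ x in Metric.ball x₀ r, ENNReal.ofReal (((1 + ‖x₀‖) * (1 + r)) ^ ⌈k⌉₊) *
        ENNReal.ofReal (1 / (1 + ‖x‖) ^ k) ∂μ.variation := by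
      refine setLIntegral_mono' measurableSet_ball fun y hy => ?_
      rw [← ENNReal.ofReal_mul (by positivity), ← ENNReal.ofReal_one]
      refine ENNReal.ofReal_le_ofReal ?_
      rw [mem_ball_iff_norm] at hy
      have h1 : 1 + ‖y‖ ≤ (1 + ‖x₀‖) * (1 + r) := by
        have := norm_le_norm_sub_add y x₀
        nlinarith [norm_nonneg x₀]
      rw [mul_one_div, le_div_iff₀ (by positivity), one_mul]
      calc (1 + ‖y‖) ^ k ≤ (1 + ‖y‖) ^ ⌈k⌉₊ := by
            rw [← Real.rpow_natCast]
            exact Real.rpow_le_rpow_of_exponent_le (by linarith [norm_nonneg y]) (Nat.le_ceil k)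
        _ ≤ _ := by gcongr
    _ ≤ _ := setLIntegral_le_lintegral _ _

theorem IsTempered.integrable_kernel (hμ : μ.IsTempered) (hd : RapidDecay φ) (hc : Continuous φ)
    (j : ℤ) (x : Rn n) : μ.Integrable (kernel φ j x) := by
  refine hμ.integrable_of_norm_le (hd.continuous_kernel hc j x) fun L => ?_
  obtain ⟨C, hC, hle⟩ := hd.exists_kernel_bound L
  set q : ℝ := 2 ^ j with hq
  have hq0 : 0 < q := by positivity
  refine ⟨C * ((2 : ℝ) ^ ((n : ℤ) * j) * (1 + ‖x‖ + q⁻¹) ^ L), fun y => (hle j x y).trans ?_⟩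
  -- Turns decay about `x` at scale 1 / q into decay about the origin. The term q⁻¹ is needed
  -- because `j` may be negative.
  have h1 : 1 + ‖y‖ ≤ (1 + ‖x‖ + q⁻¹) * (1 + q * ‖x - y‖) := by
    have h2 : ‖y‖ ≤ ‖x - y‖ + ‖x‖ := by
      rw [norm_sub_rev]; exact norm_le_norm_sub_add y x
    have h3 : q⁻¹ * (q * ‖x - y‖) = ‖x - y‖ := inv_mul_cancel_left₀ hq0.ne' _
    have h4 : 0 ≤ (1 + ‖x‖) * (q * ‖x - y‖) := by positivity
    have h5 : 0 < q⁻¹ := by positivity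
    linarith
  have h2 : 1 / (1 + q * ‖x - y‖) ^ L ≤ (1 + ‖x‖ + q⁻¹) ^ L * (1 / (1 + ‖y‖) ^ L) := by
    rw [mul_one_div, div_le_div_iff₀ (by positivity) (by positivity), one_mul, ← mul_pow]
    gcongr
  calc _ ≤ C * ((2 : ℝ) ^ ((n : ℤ) * j) * ((1 + ‖x‖ + q⁻¹) ^ L * (1 / (1 + ‖y‖) ^ L))) := by gcongr
    _ = _ := by ring

end ComplexRadonMeasure

/-- Convergence of the expansion at the density points. -/
theorem IsLebesgueDensityPoint.tendsto_expansion {μ : ComplexRadonMeasure n} {x₀ : Rn n} {γ : ℂ}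
    (h : IsLebesgueDensityPoint μ x₀ γ) (hμ : μ.IsTempered) (hd : RapidDecay φ)
    (hc : Continuous φ) (hone : ∀ x, ∫ y, kernelZero φ x y = 1) :
    Tendsto (fun j : ℤ => expansion φ μ j x₀) atTop (𝓝 γ) := by
  set σ := μ.subDensity (fun _ => γ) (locallyIntegrable_const γ) with hσ
  obtain ⟨A, K, hA, hgrow⟩ := hμ.exists_variation_ball_le x₀
  set w := volume.real (Metric.ball (0 : Rn n) 1) with hw
  have hgrow' : ∀ r : ℝ, 0 < r → σ.variation (Metric.ball x₀ r) ≤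
      ENNReal.ofReal ((A + ‖γ‖ * w) * (1 + r) ^ (K + n)) := by
    intro r hr
    refine (μ.variation_subDensity_const_le γ _).trans ?_
    have hvol : volume (Metric.ball x₀ r) = ENNReal.ofReal (r ^ n * w) := by
      rw [hw, ← volume_real_ball x₀ hr, ofReal_measureReal]
    rw [Measure.add_apply, Measure.smul_apply, smul_eq_mul, hvol, ← ofReal_norm,
      ← ENNReal.ofReal_mul (norm_nonneg γ)]
    refine (add_le_add_left (hgrow r hr) _).trans ?_
    rw [← ENNReal.ofReal_add (by positivity) (by positivity)]
    refine ENNReal.ofReal_le_ofReal ?_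
    have h1 : (1 + r) ^ K ≤ (1 + r) ^ (K + n) :=
      pow_le_pow_right₀ (by linarith) (Nat.le_add_right K n)
    have h2 : r ^ n ≤ (1 + r) ^ (K + n) :=
      (pow_le_pow_left₀ hr.le (by linarith) n).trans
        (pow_le_pow_right₀ (by linarith) (Nat.le_add_left n K))
    calc A * (1 + r) ^ K + ‖γ‖ * (r ^ n * w)
        ≤ A * (1 + r) ^ (K + n) + ‖γ‖ * ((1 + r) ^ (K + n) * w) := by gcongr
      _ = _ := by ring
  -- The variation of σ grows with exponent K + n, the extra `n` coming from γ m; this is the least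
  -- decay that the concentration lemma accepts.
  obtain ⟨C, hC, hle⟩ := hd.exists_kernel_bound (n + (K + n) + 1)
  have hlim := ENNReal.Tendsto.const_mul (a := ENNReal.ofReal C) (tendsto_lintegral_concentrating
    hgrow' h.subDensity_const.tendsto_variation_ball le_rfl) (Or.inr ENNReal.ofReal_ne_top)
  rw [mul_zero] at hlim
  rw [← Nat.map_cast_int_atTop, tendsto_map'_iff, tendsto_iff_edist_tendsto_0]
  refine tendsto_of_tendsto_of_tendsto_of_le_of_le tendsto_const_nhds hlim
    (fun _ => bot_le) fun j => ?_
  -- Mass one enters here: ∫ q_j(x₀, ·) dσ is exactly the error (q_j μ)(x₀) − γ.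
  have hint := μ.integral_subDensity_const γ (hμ.integrable_kernel hd hc j x₀)
    (hd.integrable_kernel hc j x₀)
  rw [integral_kernel, hone, one_mul] at hint
  simp only [Function.comp_apply]
  rw [edist_eq_enorm_sub, expansion]
  change ‖μ.integral (kernel φ j x₀) - γ‖ₑ ≤ _
  rw [← hint, ← lintegral_const_mul' _ _ ENNReal.ofReal_ne_top]
  refine (ComplexRadonMeasure.enorm_integral_le _ _).trans (lintegral_mono fun y => ?_)
  rw [← ENNReal.ofReal_mul hC, ← ofReal_norm]
  refine ENNReal.ofReal_le_ofReal ((hle j x₀ y).trans (le_of_eq ?_))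
  rw [zpow_natCast, ← Nat.cast_mul, zpow_natCast]

end Expansion

end MRAPaper

end

theorem theorem1p2 (n : ℕ)
    (V : ℤ → Submodule ℂ (MRAPaper.L2 n)) (hV : MRAPaper.IsMRA V)
    (φ : MRAPaper.Rn n → ℂ) (hφ : MRAPaper.IsScalingFunction V φ)
    (hφ_cont : Continuous φ)
    (hφ_decay : ∀ l : ℕ, Tendsto (fun x : MRAPaper.Rn n => (‖x‖ ^ l : ℝ) • φ x)
      (Bornology.cobounded (MRAPaper.Rn n)) (𝓝 0))
    (μ : MRAPaper.ComplexRadonMeasure n) (hμ : μ.IsTempered) :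
    -- the kernel `q₀` and the expansions `q_j μ` are well defined
    (∀ x y : MRAPaper.Rn n, Summable fun m : Fin n → ℤ =>
      φ (x - MRAPaper.latticePoint m) * conj (φ (y - MRAPaper.latticePoint m))) ∧
    (∀ (j : ℤ) (x : MRAPaper.Rn n), μ.Integrable (MRAPaper.kernel φ j x)) ∧
    -- convergence at the Lebesgue density points
    (∀ (x₀ : MRAPaper.Rn n) (γ : ℂ), MRAPaper.IsLebesgueDensityPoint μ x₀ γ →
      Tendsto (fun j : ℤ => MRAPaper.expansion φ μ j x₀) atTop (𝓝 γ)) ∧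
    -- the Lebesgue decomposition exists, and almost every point is a density point with value `f x₀`
    (∃ (f : MRAPaper.Rn n → ℂ) (μs : MRAPaper.ComplexRadonMeasure n),
      μ.IsLebesgueDecomposition f μs) ∧
    (∀ (f : MRAPaper.Rn n → ℂ) (μs : MRAPaper.ComplexRadonMeasure n),
      μ.IsLebesgueDecomposition f μs →
        ∀ᵐ x₀ ∂(volume : Measure (MRAPaper.Rn n)),
          MRAPaper.IsLebesgueDensityPoint μ x₀ (f x₀) ∧
          Tendsto (fun j : ℤ => MRAPaper.expansion φ μ j x₀) atTop (𝓝 (f x₀))) := by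
  have hd := MRAPaper.rapidDecay_of_tendsto hφ_cont hφ_decay
  have hlim : ∀ (x₀ : MRAPaper.Rn n) (γ : ℂ), MRAPaper.IsLebesgueDensityPoint μ x₀ γ →
      Tendsto (fun j : ℤ => MRAPaper.expansion φ μ j x₀) atTop (𝓝 γ) := fun x₀ γ h =>
    h.tendsto_expansion hμ hd hφ_cont (hV.integral_kernelZero_eq_one hφ hd hφ_cont)
  refine ⟨fun x y => ?_, hμ.integrable_kernel hd hφ_cont, hlim,
    μ.exists_isLebesgueDecomposition, fun f μs h => ?_⟩
  · obtain ⟨C, _, hC⟩ := hd.exists_kernelZero_bound 0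
    exact (hC x y).1
  · filter_upwards [h.ae_isLebesgueDensityPoint] with x hx
    exact ⟨hx, hlim x _ hx⟩
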